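/- Let $R$ be a commutative ring and $\delta\in R$. For natural numbers $n,m$ of the same parity, an $(n,m)$-diagram consists of $n$ source sites in a left column and $m$ target sites in a right column, both numbered from top to bottom, paired by non-crossing lines in the strip between the columns, up to isotopy. In the Temperley–Lieb category the space of morphisms $\underline n\to\underline m$ is the free $R$-module on the $(n,m)$-diagrams, and composition is bilinear, given on diagrams by gluing (in $f\circ g$ the diagram of $f$ is on the left and that of $g$ on the right), every closed loop being replaced by a factor $\delta$. An $(n,m)$-diagram is monic if $m\le n$ and exactly $m$ of its source sites are connected to target sites. The quantum numbers $[n]\in\mathbb Z[\delta]$ are given by $[0]=0$, $[1]=1$, $\delta[n]=[n+1]+[n-1]$ (so $[n]=\frac{q^n-q^{-n}}{q-q^{-1}}$ for $\delta=q+q^{-1}$), and $[n]!=[1][2]\cdots[n]$, $\genfrac{[}{]}{0pt}{}{n}{r}=\frac{[n]!}{[r]!\,[n-r]!}$. These Gaussian binomials are polynomials in $\delta$ and are evaluated in $R$. For a monic $(r,s)$-diagram $x$, rotate the target sites below the source sites to obtain an $(r+s,0)$-diagram in which target site $t$ becomes source site $r+s+1-t$. Let $F(x)$ be the set of its edges,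 partially ordered by $e_1\le e_2$ iff $e_1$ lies in the region enclosed by $e_2$ and the left border. Put $$h_{F(x)}=\frac{[\,|F(x)|\,]!}{\prod_{e\in F(x)}[c(e)]},\qquad c(e)=|\{f\in F(x): f\le e\}|,$$ which is a polynomial in $\delta$, evaluated in $R$. The candidate morphism is $v_{r,s}=\sum_x h_{F(x)}\,x:\underline r\to\underline s$, the sum being over all monic $(r,s)$-diagrams $x$. **Proposition.** Let $a\ge b\ge c$ be natural numbers of the same parity. Then $$v_{a,b}\circ v_{b,c}=\genfrac{[}{]}{0pt}{}{\frac{a-c}{2}}{\frac{a-b}{2}}\,v_{a,c}.$$ -/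

import Mathlib

namespace TemperleyLieb

open Polynomial

/-! ### Quantum numbers -/

/-- The quantum number `[n]`, a polynomial in the indeterminate `δ`, for `n : ℤ`: it is the
rescaled Chebyshev polynomial of the second kind `S_{n-1}`.  The three lemmas that follow
(`[0] = 0`, `[1] = 1`, `δ [n] = [n+1] + [n-1]`) characterise it. -/
noncomputable def quantumNumber (n : ℤ) : ℤ[X] := Chebyshev.S ℤ (n - 1)

theorem quantumNumber_zero : quantumNumber 0 = 0 := by
  simp [quantumNumber]

theorem quantumNumber_one : quantumNumber 1 = 1 := by
  simp [quantumNumber]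

theorem X_mul_quantumNumber (n : ℤ) :
    X * quantumNumber n = quantumNumber (n + 1) + quantumNumber (n - 1) := by
  have h := Chebyshev.S_sub_one ℤ (n - 1)
  simp only [quantumNumber, add_sub_cancel_right, sub_add_cancel] at h ⊢
  rw [h]; ring

/-- The quantum factorial `[n]! = [1] [2] ⋯ [n]`. -/
noncomputable def quantumFactorial (n : ℕ) : ℤ[X] :=
  ∏ i ∈ Finset.range n, quantumNumber ((i : ℤ) + 1)

/-- The Gaussian binomial coefficient `[n]! / ([r]! [n-r]!)` for `r ≤ n`, as a polynomial in `δ`.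
The denominator is monic and the division is exact, see `gaussianBinomial_mul`. -/
noncomputable def gaussianBinomial (n r : ℕ) : ℤ[X] :=
  quantumFactorial n /ₘ (quantumFactorial r * quantumFactorial (n - r))

/-- For a finite forest `F` and `c x = #{y ∈ F | y ≤ x}`, the polynomial
`h_F = [|F|]! / ∏ x, [c x]` in `δ`.
The denominator is monic and the division is exact, see `forestPolynomial_mul`. -/
noncomputable def forestPolynomial (F : Type) [Fintype F] [PartialOrder F] : ℤ[X] :=
  quantumFactorial (Fintype.card F) /ₘ ∏ x : F, quantumNumber (Nat.card {y : F // y ≤ x})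

theorem quantumNumber_monic_aux (n : ℕ) :
    ((quantumNumber (n + 1)).Monic ∧ (quantumNumber (n + 1)).natDegree = n) ∧
      ((quantumNumber (n + 2)).Monic ∧ (quantumNumber (n + 2)).natDegree = n + 1) := by
  induction n with
  | zero =>
    have h := X_mul_quantumNumber 1
    norm_num [quantumNumber_one, quantumNumber_zero] at h
    norm_num [quantumNumber_one, ← h, monic_X]
  | succ k ih =>
    obtain ⟨⟨h1, d1⟩, h2, d2⟩ := ih
    have h := X_mul_quantumNumber ((k : ℤ) + 2)
    have e : quantumNumber (((k + 1 : ℕ) : ℤ) + 2)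
        = X * quantumNumber ((k : ℤ) + 2) - quantumNumber ((k : ℤ) + 1) := by
      rw [h]
      push_cast
      ring_nf
    have hm : (X * quantumNumber ((k : ℤ) + 2)).Monic := monic_X.mul h2
    have hd : (X * quantumNumber ((k : ℤ) + 2)).natDegree = k + 2 := by
      rw [monic_X.natDegree_mul h2, d2, natDegree_X]; ring
    have hlt : (quantumNumber ((k : ℤ) + 1)).degree < (X * quantumNumber ((k : ℤ) + 2)).degree := by
      apply degree_lt_degree
      omega
    have e2 : ((k + 1 : ℕ) : ℤ) + 1 = (k : ℤ) + 2 := by push_cast; ring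
    refine ⟨by rw [e2]; exact ⟨h2, d2⟩, ?_⟩
    rw [e]
    refine ⟨hm.sub_of_left hlt, ?_⟩
    rw [natDegree_sub_eq_left_of_natDegree_lt (by omega), hd]

theorem quantumNumber_monic {n : ℕ} (hn : 0 < n) : (quantumNumber n).Monic := by
  obtain ⟨k, rfl⟩ := Nat.exists_eq_succ_of_ne_zero hn.ne'
  simpa using (quantumNumber_monic_aux k).1.1

theorem quantumFactorial_monic (n : ℕ) : (quantumFactorial n).Monic :=
  monic_prod_of_monic _ _ fun i _ => by
    simpa using quantumNumber_monic (Nat.succ_pos i)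

theorem quantumFactorial_succ (n : ℕ) :
    quantumFactorial (n + 1) = quantumFactorial n * quantumNumber ((n : ℤ) + 1) := by
  simp [quantumFactorial, Finset.prod_range_succ]

theorem quantumNumber_add (m : ℤ) (n : ℕ) :
    quantumNumber (m + n)
      = quantumNumber m * quantumNumber (n + 1) - quantumNumber (m - 1) * quantumNumber n := by
  suffices h : ∀ m : ℤ, quantumNumber (m + n)
      = quantumNumber m * quantumNumber (n + 1) - quantumNumber (m - 1) * quantumNumber n from h m
  induction n with
  | zero => intro m; simp [quantumNumber_zero, quantumNumber_one]
  | succ k ih =>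
    intro m
    have h1 := ih (m + 1)
    have h2 := X_mul_quantumNumber m
    have h3 := X_mul_quantumNumber ((k : ℤ) + 1)
    have e1 : m + ((k + 1 : ℕ) : ℤ) = m + 1 + k := by push_cast; ring
    have e2 : ((k + 1 : ℕ) : ℤ) + 1 = (k : ℤ) + 1 + 1 := by push_cast; ring
    have e3 : ((k + 1 : ℕ) : ℤ) = (k : ℤ) + 1 := by push_cast; ring
    rw [e1, h1, e2, e3]
    simp only [add_sub_cancel_right] at h3 ⊢
    linear_combination (-quantumNumber (k + 1)) * h2 + quantumNumber m * h3

theorem quantumFactorial_dvd (r s : ℕ) :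
    quantumFactorial r * quantumFactorial s ∣ quantumFactorial (r + s) := by
  induction h : r + s generalizing r s with
  | zero =>
    obtain ⟨rfl, rfl⟩ : r = 0 ∧ s = 0 := by omega
    simp [quantumFactorial]
  | succ n ih =>
    rcases r with _ | r
    · have : s = n + 1 := by omega
      subst this; simp [quantumFactorial]
    rcases s with _ | s
    · have : r = n := by omega
      subst this; simp [quantumFactorial]
    have hn : (n : ℤ) + 1 = ((r : ℤ) + 1) + ((s + 1 : ℕ) : ℤ) := by push_cast; omega
    have key := quantumNumber_add ((r : ℤ) + 1) (s + 1)
    rw [quantumFactorial_succ n, hn, key, mul_sub]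
    obtain ⟨u, hu⟩ := ih r (s + 1) (by omega)
    obtain ⟨w, hw⟩ := ih (r + 1) s (by omega)
    refine dvd_sub ⟨u * quantumNumber (((s + 1 : ℕ) : ℤ) + 1), ?_⟩
      ⟨w * quantumNumber (r + 1 - 1), ?_⟩
    · rw [hu, quantumFactorial_succ r]; ring
    · rw [hw, quantumFactorial_succ s]; push_cast; ring

theorem gaussianBinomial_mul {n r : ℕ} (h : r ≤ n) :
    gaussianBinomial n r * (quantumFactorial r * quantumFactorial (n - r)) = quantumFactorial n := by
  have hm := (quantumFactorial_monic r).mul (quantumFactorial_monic (n - r))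
  have hd := quantumFactorial_dvd r (n - r)
  rw [Nat.add_sub_cancel' h] at hd
  have := modByMonic_add_div (quantumFactorial n) (quantumFactorial r * quantumFactorial (n - r))
  rw [(modByMonic_eq_zero_iff_dvd hm).2 hd, zero_add] at this
  rw [gaussianBinomial, mul_comm]; exact this

open Classical in
theorem prod_quantumNumber_dvd {F : Type} [PartialOrder F]
    (hF : ∀ a b c : F, a ≤ b → a ≤ c → b ≤ c ∨ c ≤ b) (n : ℕ) (S : Finset F) (hS : S.card = n) :
    (∏ x ∈ S, quantumNumber (S.filter (· ≤ x)).card) ∣ quantumFactorial n := by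
  induction n using Nat.strong_induction_on generalizing S with
  | _ n ih =>
  rcases S.eq_empty_or_nonempty with rfl | hne
  · simp
  obtain ⟨r, hr⟩ := S.exists_maximal hne
  have hrS : r ∈ S := hr.prop
  set A := (S.filter (· ≤ r)).erase r with hA
  set B := S.filter (fun x => ¬ x ≤ r) with hB
  have hrF : r ∈ S.filter (· ≤ r) := by simp [hrS]
  have hcA : A.card + 1 = (S.filter (· ≤ r)).card := Finset.card_erase_add_one hrF
  have hcS : (S.filter (· ≤ r)).card + B.card = n := by
    rw [← hS]; exact Finset.card_filter_add_card_filter_not _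
  have hfA : ∀ x ∈ A, S.filter (· ≤ x) = A.filter (· ≤ x) := by
    intro x hx
    simp only [hA, Finset.mem_erase, Finset.mem_filter] at hx
    ext y
    simp only [hA, Finset.mem_filter, Finset.mem_erase]
    constructor
    · rintro ⟨h1, h2⟩
      refine ⟨⟨?_, h1, h2.trans hx.2.2⟩, h2⟩
      rintro rfl
      exact hx.1 (le_antisymm hx.2.2 h2)
    · rintro ⟨⟨_, h1, _⟩, h2⟩; exact ⟨h1, h2⟩
  have hfB : ∀ x ∈ B, S.filter (· ≤ x) = B.filter (· ≤ x) := by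
    intro x hx
    simp only [hB, Finset.mem_filter] at hx
    ext y
    simp only [hB, Finset.mem_filter]
    constructor
    · rintro ⟨h1, h2⟩
      refine ⟨⟨h1, fun h3 => ?_⟩, h2⟩
      rcases hF y x r h2 h3 with h | h
      · exact hx.2 h
      · exact hx.2 (hr.le_of_ge hx.1 h)
    · rintro ⟨⟨h1, _⟩, h2⟩; exact ⟨h1, h2⟩
  have iA := ih A.card (by omega) A rfl
  have iB := ih B.card (by omega) B rfl
  have hd := quantumFactorial_dvd (A.card + 1) B.card
  rw [hcA, hcS] at hd
  refine dvd_trans ?_ hd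
  rw [← Finset.prod_filter_mul_prod_filter_not S (· ≤ r), ← hcA]
  refine mul_dvd_mul ?_ ?_
  · rw [← Finset.prod_erase_mul _ _ hrF, quantumFactorial_succ, ← hA]
    refine mul_dvd_mul ?_ (by rw [← hcA]; push_cast; rfl)
    rw [Finset.prod_congr rfl fun x hx => by rw [hfA x hx]]
    exact iA
  · rw [← hB, Finset.prod_congr rfl fun x hx => by rw [hfB x hx]]
    exact iB

theorem forestPolynomial_mul (F : Type) [Fintype F] [PartialOrder F]
    (hF : ∀ a b c : F, a ≤ b → a ≤ c → b ≤ c ∨ c ≤ b) :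
    forestPolynomial F * ∏ x : F, quantumNumber (Nat.card {y : F // y ≤ x})
      = quantumFactorial (Fintype.card F) := by
  classical
  have hm : (∏ x : F, quantumNumber (Nat.card {y : F // y ≤ x})).Monic := by
    refine monic_prod_of_monic _ _ fun x _ => quantumNumber_monic ?_
    have : Nonempty {y : F // y ≤ x} := ⟨⟨x, le_rfl⟩⟩
    exact Nat.card_pos
  have hd : (∏ x : F, quantumNumber (Nat.card {y : F // y ≤ x}))
      ∣ quantumFactorial (Fintype.card F) := by
    have h := prod_quantumNumber_dvd hF _ Finset.univ rfl
    rw [Finset.card_univ] at h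
    convert h using 4
    rw [Nat.card_eq_fintype_card, Fintype.card_subtype]
  have := modByMonic_add_div (quantumFactorial (Fintype.card F))
    (∏ x : F, quantumNumber (Nat.card {y : F // y ≤ x}))
  rw [(modByMonic_eq_zero_iff_dvd hm).2 hd, zero_add] at this
  rw [forestPolynomial, mul_comm]; exact this

/-! ### Diagrams -/

/-- The place of a site when the border of the strip is traversed down the column of the `n`
source sites and then up the column of the `m` target sites.  Sites are numbered from top to
bottom, starting at `0`.  This is also the rotation which turns an `(n,m)`-diagram into an
`(n+m,0)`-diagram: with sites numbered from `1`, target site `m-j+n+1` becomes source site `j`. -/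
def pos {n m : ℕ} : Fin n ⊕ Fin m → ℕ
  | Sum.inl i => i
  | Sum.inr j => n + (m - 1 - j)

theorem pos_injective {n m : ℕ} : Function.Injective (pos : Fin n ⊕ Fin m → ℕ) := by
  rintro (i | i) (j | j) h <;> simp only [pos] at h <;> congr 1 <;> omega

/-- An `(n,m)`-diagram up to deformation: a pairing of the `n` source sites (`Sum.inl`) and the `m`
target sites (`Sum.inr`) by lines which do not cross. -/
@[ext]
structure Diagram (n m : ℕ) where
  /-- the site at the other end of the line -/
  partner : Fin n ⊕ Fin m → Fin n ⊕ Fin m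
  partner_partner : ∀ p, partner (partner p) = p
  partner_ne : ∀ p, partner p ≠ p
  planar : ∀ p q, ¬ (pos p < pos q ∧ pos q < pos (partner p) ∧ pos (partner p) < pos (partner q))

noncomputable instance (n m : ℕ) : Fintype (Diagram n m) :=
  haveI : Finite (Diagram n m) :=
    Finite.of_injective Diagram.partner fun _ _ h => Diagram.ext h
  Fintype.ofFinite _

namespace Diagram

variable {n m k : ℕ}

/-- The number of source sites connected to target sites. -/
noncomputable def propagationNumber (x : Diagram n m) : ℕ :=
  Nat.card {i : Fin n // ∃ j : Fin m, x.partner (Sum.inl i) = Sum.inr j}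

/-- An `(n,m)`-diagram is monic if `m ≤ n` and its propagation number is the largest possible. -/
def IsMonic (x : Diagram n m) : Prop := m ≤ n ∧ x.propagationNumber = m

/-- A diagram as a graph on its sites. -/
def graph (x : Diagram n m) : SimpleGraph (Fin n ⊕ Fin m) where
  Adj p q := x.partner p = q
  symm := ⟨fun p q h => by rw [← h, x.partner_partner]⟩
  loopless := ⟨fun p h => x.partner_ne p h⟩

/-- The result of identifying the target sites of `x` with the source sites of `y`, as a graph
whose vertices are source sites of `x`, middle sites, and target sites of `y`. -/
def glue (x : Diagram n m) (y : Diagram m k) : SimpleGraph (Fin n ⊕ (Fin m ⊕ Fin k)) :=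
  x.graph.map ((Function.Embedding.refl (Fin n)).sumMap Function.Embedding.inl) ⊔
    y.graph.map Function.Embedding.inr

/-- `z` is the diagram obtained by gluing `x` and `y` and deleting all closed loops: two different
outer sites are joined in `z` exactly if they are connected in the glued picture. -/
def IsComposite (x : Diagram n m) (y : Diagram m k) (z : Diagram n k) : Prop :=
  ∀ p q : Fin n ⊕ Fin k, z.partner p = q ↔
    p ≠ q ∧ (x.glue y).Reachable (Sum.map id Sum.inr p) (Sum.map id Sum.inr q)

/-- The number of closed loops that appear when `x` and `y` are glued: connected components
consisting of middle sites only. -/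
noncomputable def loops (x : Diagram n m) (y : Diagram m k) : ℕ :=
  Nat.card {C : (x.glue y).ConnectedComponent //
    C.supp ⊆ Set.range fun j : Fin m => Sum.inr (Sum.inl j)}

/-- The edges of the `(n+m,0)`-diagram obtained by rotating the target sites of `x`; an edge is
represented by its first end point. -/
def Edge (x : Diagram n m) : Type := {p : Fin n ⊕ Fin m // pos p < pos (x.partner p)}

noncomputable instance (x : Diagram n m) : Fintype x.Edge :=
  haveI : Finite x.Edge := Subtype.finite
  Fintype.ofFinite _

/-- The forest of `x`: its elements are the edges of the rotated diagram, and `e₁ ≤ e₂` if and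
only if `e₁` lies in the area enclosed by `e₂` and the left border. -/
instance (x : Diagram n m) : PartialOrder x.Edge where
  le e f := pos f.1 ≤ pos e.1 ∧ pos (x.partner e.1) ≤ pos (x.partner f.1)
  le_refl _ := ⟨le_rfl, le_rfl⟩
  le_trans _ _ _ h h' := ⟨h'.1.trans h.1, h.2.trans h'.2⟩
  le_antisymm _ _ h h' := Subtype.ext (pos_injective (le_antisymm h'.1 h.1))

theorem edge_forest (x : Diagram n m) (a b c : x.Edge) (hb : a ≤ b) (hc : a ≤ c) :
    b ≤ c ∨ c ≤ b := by
  obtain ⟨hb1, hb2⟩ := hb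
  obtain ⟨hc1, hc2⟩ := hc
  have ha := a.2
  have h1 := x.planar b.1 c.1
  have h2 := x.planar c.1 b.1
  rcases lt_trichotomy (pos b.1) (pos c.1) with h | h | h
  · exact Or.inr ⟨h.le, by omega⟩
  · have : b = c := Subtype.ext (pos_injective h)
    exact Or.inl this.le
  · exact Or.inl ⟨h.le, by omega⟩

/-- The coefficient of a diagram in a candidate morphism is an exact quotient. -/
theorem forestPolynomial_edge_mul (x : Diagram n m) :
    forestPolynomial x.Edge * ∏ e : x.Edge, quantumNumber (Nat.card {f : x.Edge // f ≤ e})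
      = quantumFactorial (Fintype.card x.Edge) :=
  forestPolynomial_mul x.Edge x.edge_forest

end Diagram

/-! ### Morphisms -/

/-- The morphisms `n ⟶ m` in the Temperley-Lieb category over `R`: the free module on the
`(n,m)`-diagrams, a morphism being given by its coefficients. -/
abbrev Hom (R : Type*) (n m : ℕ) : Type _ := Diagram n m → R

open Classical in
/-- Composition `n ⟶ m ⟶ k` (first `f`, then `g`, drawn from left to right) in the Temperley-Lieb
category with loop parameter `δ`: the bilinear map which sends a pair of diagrams `x`, `y` to
`δ ^ loops x y` times the diagram obtained by gluing. -/
noncomputable def comp {R : Type*} [CommRing R] (δ : R) {n m k : ℕ} (f : Hom R n m)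
    (g : Hom R m k) : Hom R n k :=
  fun z => ∑ x : Diagram n m, ∑ y : Diagram m k,
    if x.IsComposite y z then f x * g y * δ ^ x.loops y else 0

open Classical in
/-- The candidate morphism `v_{r,s} = ∑ h_{F(x)} x`, the sum over all monic `(r,s)`-diagrams,
with coefficients specialised to `(R, δ)`. -/
noncomputable def candidate {R : Type*} [CommRing R] (δ : R) (r s : ℕ) : Hom R r s :=
  fun x => if x.IsMonic then aeval δ (forestPolynomial x.Edge) else 0

end TemperleyLieb

namespace TemperleyLieb

open Polynomial
open Finset.HasAntidiagonal (antidiagonal mem_antidiagonal)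

/-! ### Quantum numbers in the field of fractions -/

/-! Gluing monic diagrams closes no loop, since every middle site is joined by the left factor to a
source site, and the result is again monic. So the theorem compares coefficients at each monic `z`:
a sum of products `h_{F(x)} h_{F(y)}` over the factorizations of `z` into monic `x` and `y`. A
factorization amounts to the set `S` of cups of `z` that already occur in `x`; the other source
sites start through lines of `x`, and planarity says exactly that `S` contains with a cup all cups
enclosed by it. Both coefficients are quotients of a quantum factorial by a hook product read off
from `z` and `S`: `cutProd` for `x`, `hookProd` of the complement of `S` for `y`. What remains is
the forest identity `sum_lowerSets_card_eq`.

It is a case of `sum_lowerSets_eq`, in which the term of `S` is weighted by an arbitrary function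
`ψ` of the number of lines of `x`, and the hooks of through lines are lengthened by a parameter `M`
that stands for lines further below. For a single cup, kept or cut, the sum is `transfer`: `(Tψ)(M)
= ψ(M+1) + ψ(M+2) / ([M+1][M+2])`. The claim is that `n` cups act as `T^n` in whatever way they are
nested, up to the hook product of `z` and a factor for the through lines. Juxtaposition of cups is
composition of powers; enclosing cups by another one is `transfer_iterate_succ_eq_nest`; a through
line in front is `transfer_iterate_bar`. The last two are read off from the closed form of `T^n` in
`transfer_iterate`, which rests on `[k+j][k+j+c] = [k][k+2j+c] + [j][j+c]`. Taking for `ψ` the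
indicator of one value selects `|S| = s`, and the coefficient found there is the Gaussian binomial
up to factorials.

The hook computations take place in the fraction field of `ℤ[δ]`, where `[n] ≠ 0` for `n > 0`; the
identity of polynomials so obtained is then specialised to `R`. -/

/-- The quantum number `[n]` in the field of fractions of `ℤ[δ]`. -/
noncomputable def qNum (n : ℕ) : FractionRing ℤ[X] :=
  algebraMap ℤ[X] (FractionRing ℤ[X]) (quantumNumber n)

/-- The quantum factorial `[n]!` in the field of fractions of `ℤ[δ]`. -/
noncomputable def qFact (n : ℕ) : FractionRing ℤ[X] :=
  algebraMap ℤ[X] (FractionRing ℤ[X]) (quantumFactorial n)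

theorem qNum_zero : qNum 0 = 0 := by simp [qNum, quantumNumber_zero]

theorem qNum_ne_zero {n : ℕ} (hn : 0 < n) : qNum n ≠ 0 := by
  rw [qNum, Ne, FaithfulSMul.algebraMap_eq_zero_iff]
  exact (quantumNumber_monic hn).ne_zero

theorem qNum_succ_ne_zero (n : ℕ) : qNum (n + 1) ≠ 0 := qNum_ne_zero n.succ_pos

theorem qFact_ne_zero (n : ℕ) : qFact n ≠ 0 := by
  rw [qFact, Ne, FaithfulSMul.algebraMap_eq_zero_iff]
  exact (quantumFactorial_monic n).ne_zero

theorem qFact_zero : qFact 0 = 1 := by simp [qFact, quantumFactorial]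

theorem qFact_succ (n : ℕ) : qFact (n + 1) = qFact n * qNum (n + 1) := by
  simp [qFact, qNum, quantumFactorial_succ]

/-- The quadratic form on the left is invariant under the recursion: consecutive instances differ by
a multiple of `δ[k] = [k+1] + [k-1]`. -/
theorem quantumNumber_sq_add_sq (k : ℕ) :
    quantumNumber ((k : ℤ) - 1) ^ 2 + quantumNumber k ^ 2
      - X * quantumNumber k * quantumNumber ((k : ℤ) - 1) = 1 := by
  induction k with
  | zero =>
    have h := X_mul_quantumNumber 0
    simp only [quantumNumber_zero, zero_add, quantumNumber_one, mul_zero] at h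
    simp only [Nat.cast_zero, quantumNumber_zero]
    linear_combination (-1 + quantumNumber (0 - 1)) * -h
  | succ k ih =>
    have h := X_mul_quantumNumber k
    push_cast
    rw [add_sub_cancel_right]
    linear_combination ih + (quantumNumber (k - 1) - quantumNumber (k + 1)) * h

/-- After expansion by the addition formula, and modulo the recursion at `j`, the difference of the
sides is `[j][j+c]` times the quadratic relation at `k`. -/
theorem quantumNumber_mul_quantumNumber (k j c : ℕ) :
    quantumNumber ((k + j : ℕ) : ℤ) * quantumNumber ((k + j + c : ℕ) : ℤ)
      = quantumNumber k * quantumNumber ((k + 2 * j + c : ℕ) : ℤ)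
        + quantumNumber j * quantumNumber ((j + c : ℕ) : ℤ) := by
  have h1 := quantumNumber_add k j
  have h2 := quantumNumber_add k (j + c)
  have h3 := quantumNumber_add k (j + (j + c))
  have h4 := quantumNumber_add ((j : ℤ) + 1) (j + c)
  have h5 := quantumNumber_add j (j + c)
  have h6 := quantumNumber_sq_add_sq k
  have h7 := X_mul_quantumNumber j
  have e1 : ((k + j + c : ℕ) : ℤ) = k + (j + c : ℕ) := by push_cast; ring
  have e2 : ((k + 2 * j + c : ℕ) : ℤ) = k + (j + (j + c) : ℕ) := by push_cast; ring
  have e3 : ((j + (j + c) : ℕ) : ℤ) + 1 = (j : ℤ) + 1 + (j + c : ℕ) := by push_cast; ring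
  have e4 : ((j + (j + c) : ℕ) : ℤ) = (j : ℤ) + (j + c : ℕ) := by push_cast; ring
  rw [Nat.cast_add k j, e1, e2, h1, h2, h3, e3, e4, h4, h5, add_sub_cancel_right]
  linear_combination quantumNumber j * quantumNumber ((j + c : ℕ) : ℤ) * h6
    + quantumNumber k * quantumNumber (k - 1) * quantumNumber ((j + c : ℕ) : ℤ) * h7

theorem qNum_mul_qNum (k j c : ℕ) :
    qNum (k + j) * qNum (k + j + c) = qNum k * qNum (k + 2 * j + c) + qNum j * qNum (j + c) := by
  simp only [qNum, ← map_mul, ← map_add, quantumNumber_mul_quantumNumber]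

/-! ### Powers of the transfer operator -/

/-- The transfer operator of a single line which is either kept or cut into two ends. -/
noncomputable def transfer (ψ : ℕ → FractionRing ℤ[X]) (M : ℕ) : FractionRing ℤ[X] :=
  ψ (M + 1) + ψ (M + 2) / (qNum (M + 1) * qNum (M + 2))

/-- The matrix entries of the powers of the transfer operator. -/
noncomputable def transferCoeff (k j M : ℕ) : FractionRing ℤ[X] :=
  qFact (k + j) * qFact M * qFact (M + k + j)
    / (qFact k * qFact j * qFact (M + k + 2 * j) * qFact (M + j))

/-- The factors `[k+j][M+k+j]` of the numerator are split by `qNum_mul_qNum`. The two summands match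
the two ways to reach `(k, j)` in the induction below: from `(k-1, j)` by keeping a line, from `(k,
j-1)` by cutting one. -/
theorem transferCoeff_split (k j M : ℕ) (h : 0 < k + j) :
    transferCoeff k j M = qFact (k + j - 1) * qFact M * qFact (M + k + j - 1)
      / (qFact k * qFact j * qFact (M + k + 2 * j) * qFact (M + j))
        * (qNum k * qNum (M + k + 2 * j) + qNum j * qNum (M + j)) := by
  obtain ⟨n, hn⟩ : ∃ n, k + j = n + 1 := ⟨k + j - 1, by omega⟩
  have h1 := qNum_mul_qNum k j M
  rw [show k + j + M = M + n + 1 by omega, show k + 2 * j + M = M + k + 2 * j by omega,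
    add_comm j M, hn] at h1
  rw [← h1, transferCoeff, hn, show M + k + j = M + n + 1 by omega, qFact_succ, qFact_succ]
  simp only [Nat.add_sub_cancel]
  ring

/-- A kept line raises the argument by one and a cut line by two, so `k` kept and `j` cut lines lead
to `M + n + j`. -/
theorem transfer_iterate (n : ℕ) (ψ : ℕ → FractionRing ℤ[X]) (M : ℕ) :
    transfer^[n] ψ M
      = ∑ p ∈ antidiagonal n, transferCoeff p.1 p.2 M * ψ (M + n + p.2) := by
  induction n generalizing ψ with
  | zero =>
    have h := qFact_ne_zero M
    simp [transferCoeff, qFact_zero]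
    field_simp
  | succ n ih =>
    rw [Function.iterate_succ_apply, ih]
    let f (k j : ℕ) : FractionRing ℤ[X] := qFact n * qFact M * qFact (M + n)
      / (qFact k * qFact j * qFact (M + k + 2 * j) * qFact (M + j)) * ψ (M + (n + 1) + j)
    have hR : ∑ p ∈ antidiagonal (n + 1), transferCoeff p.1 p.2 M * ψ (M + (n + 1) + p.2)
        = ∑ p ∈ antidiagonal (n + 1), f p.1 p.2 * (qNum p.1 * qNum (M + p.1 + 2 * p.2))
          + ∑ p ∈ antidiagonal (n + 1), f p.1 p.2 * (qNum p.2 * qNum (M + p.2)) := by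
      rw [← Finset.sum_add_distrib]
      refine Finset.sum_congr rfl fun p hp => ?_
      rw [mem_antidiagonal] at hp
      rw [transferCoeff_split _ _ _ (by omega), hp, show M + p.1 + p.2 - 1 = M + n by omega,
        Nat.add_sub_cancel]
      simp only [f]
      ring
    -- Both boundary terms vanish because `[0] = 0`, and the shifted sums can be compared termwise.
    rw [hR, Finset.Nat.sum_antidiagonal_succ, Finset.Nat.sum_antidiagonal_succ']
    simp only [qNum_zero, zero_mul, mul_zero, zero_add, add_zero]
    rw [← Finset.sum_add_distrib]
    refine Finset.sum_congr rfl fun p hp => ?_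
    rw [mem_antidiagonal] at hp
    obtain ⟨k, j⟩ := p
    dsimp only at hp ⊢
    subst hp
    simp only [transfer, transferCoeff, f]
    have e1 : M + (k + 1) + 2 * j = M + k + 2 * j + 1 := by ring
    have e2 : M + k + 2 * (j + 1) = M + k + 2 * j + 1 + 1 := by ring
    have e3 : M + (j + 1) = M + j + 1 := by ring
    have e4 : M + (k + j) + j + 1 = M + k + 2 * j + 1 := by ring
    have e5 : M + (k + j) + j + 2 = M + k + 2 * j + 1 + 1 := by ring
    have e6 : M + (k + j + 1) + j = M + k + 2 * j + 1 := by ring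
    have e7 : M + (k + j + 1) + (j + 1) = M + k + 2 * j + 1 + 1 := by ring
    have e8 : M + k + j = M + (k + j) := by ring
    rw [e1, e2, e3, e4, e5, e6, e7, e8]
    simp only [qFact_succ]
    have h1 := qFact_ne_zero k
    have h2 := qFact_ne_zero j
    have h3 := qFact_ne_zero (M + k + 2 * j)
    have h4 := qFact_ne_zero (M + j)
    have h5 := qNum_succ_ne_zero k
    have h6 := qNum_succ_ne_zero j
    have h7 := qNum_succ_ne_zero (M + k + 2 * j)
    have h8 := qNum_succ_ne_zero (M + k + 2 * j + 1)
    have h9 := qNum_succ_ne_zero (M + j)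
    field_simp

/-- The rule for an arc that encloses `n` arcs. If it is kept, all of them are kept, whence `ψ (M +
n + 1)`. If it is cut, its ends have the hooks `[M+1]` and `[s+1]` in the left factor, and `[s-M-n]`
is its hook in the right factor; `[n+1]` compensates its hook in the whole. Only `s = M + 1 + n + j`
occurs, so the subtraction does not truncate. In the closed form, the first term is `j = 0` and the
rest is a shift of `j`. -/
theorem transfer_iterate_succ_eq_nest (n : ℕ) (ψ : ℕ → FractionRing ℤ[X]) (M : ℕ) :
    transfer^[n + 1] ψ M = ψ (M + n + 1) + qNum (n + 1) / qNum (M + 1)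
      * transfer^[n] (fun s => ψ (s + 1) / (qNum (s + 1) * qNum (s - M - n))) (M + 1) := by
  rw [transfer_iterate, transfer_iterate, Finset.Nat.sum_antidiagonal_succ']
  congr 1
  · have h1 := qFact_ne_zero M
    have h2 := qFact_ne_zero (n + 1)
    have h3 := qFact_ne_zero (M + (n + 1))
    simp only [transferCoeff, qFact_zero, add_zero, mul_zero, mul_one, add_assoc]
    field_simp
  · rw [Finset.mul_sum]
    refine Finset.sum_congr rfl fun p hp => ?_
    rw [mem_antidiagonal] at hp
    obtain ⟨k, j⟩ := p
    dsimp only at hp ⊢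
    subst hp
    simp only [transferCoeff]
    rw [show M + 1 + (k + j) + j - M - (k + j) = j + 1 by omega,
      show M + k + (j + 1) = M + (k + j) + 1 by ring,
      show M + 1 + k + j = M + (k + j) + 1 by ring,
      show M + k + 2 * (j + 1) = M + k + 2 * j + 1 + 1 by ring,
      show M + 1 + k + 2 * j = M + k + 2 * j + 1 by ring,
      show M + (k + j + 1) + (j + 1) = M + k + 2 * j + 1 + 1 by ring,
      show M + 1 + (k + j) + j + 1 = M + k + 2 * j + 1 + 1 by ring,
      show M + 1 + j = M + j + 1 by ring, show M + (j + 1) = M + j + 1 by ring,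
      show k + (j + 1) = k + j + 1 by ring]
    simp only [qFact_succ]
    have h1 := qFact_ne_zero k
    have h2 := qFact_ne_zero j
    have h3 := qFact_ne_zero (M + k + 2 * j)
    have h4 := qFact_ne_zero (M + j)
    have h6 := qNum_succ_ne_zero j
    have h7 := qNum_succ_ne_zero (M + k + 2 * j)
    have h8 := qNum_succ_ne_zero (M + k + 2 * j + 1)
    have h9 := qNum_succ_ne_zero (M + j)
    have h10 := qNum_succ_ne_zero M
    field_simp

/-- The rule for a fixed point in front of `n` arcs, whose hook is `s + 1` in the left factor and `s
+ 1 - n` in the right one. The closed forms agree term by term. -/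
theorem transfer_iterate_bar (n : ℕ) (ψ : ℕ → FractionRing ℤ[X]) (m : ℕ) :
    qNum (n + m + 1) * qNum (m + 1)
        * transfer^[n] (fun s => ψ (s + 1) / (qNum (s + 1) * qNum (s + 1 - n))) m
      = transfer^[n] ψ (m + 1) := by
  rw [transfer_iterate, transfer_iterate, Finset.mul_sum]
  refine Finset.sum_congr rfl fun p hp => ?_
  rw [mem_antidiagonal] at hp
  obtain ⟨k, j⟩ := p
  dsimp only at hp ⊢
  subst hp
  simp only [transferCoeff]
  rw [show m + (k + j) + j + 1 - (k + j) = m + j + 1 by omega,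
    show m + 1 + k + j = m + k + j + 1 by ring, show k + j + m + 1 = m + k + j + 1 by ring,
    show m + 1 + k + 2 * j = m + k + 2 * j + 1 by ring,
    show m + 1 + j = m + j + 1 by ring,
    show m + 1 + (k + j) + j = m + k + 2 * j + 1 by ring,
    show m + (k + j) + j + 1 = m + k + 2 * j + 1 by ring]
  simp only [qFact_succ]
  have h1 := qFact_ne_zero k
  have h2 := qFact_ne_zero j
  have h3 := qFact_ne_zero (m + k + 2 * j)
  have h4 := qFact_ne_zero (m + j)
  have h7 := qNum_succ_ne_zero (m + k + 2 * j)
  have h9 := qNum_succ_ne_zero (m + j)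
  field_simp

/-! ### Lower sets of cups of a non-crossing involution -/

section Involution

variable {ι : Type*} [LinearOrder ι]

/-- An involution whose two-element orbits are non-crossing arcs, none of which encloses a fixed
point. -/
structure IsCupInvolution (ρ : ι → ι) : Prop where
  invol : ∀ i, ρ (ρ i) = i
  nest : ∀ i j, i < j → j < ρ i → i < ρ j ∧ ρ j < ρ i ∧ ρ j ≠ j

/-- The number of arcs and fixed points in `W` enclosed by the arc at `i`; a fixed point
encloses all that follows. -/
def hook (ρ : ι → ι) (W : Finset ι) (i : ι) : ℕ :=
  (W.filter fun j => i ≤ j ∧ j ≤ ρ j ∧ (ρ i = i ∨ ρ j ≤ ρ i)).card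

/-- The hook product of `W`, with the hooks of fixed points lengthened by `M`. -/
noncomputable def hookProd (ρ : ι → ι) (W : Finset ι) (M : ℕ) : FractionRing ℤ[X] :=
  ∏ i ∈ W with i ≤ ρ i, qNum (hook ρ W i + if ρ i = i then M else 0)

/-- The hook product obtained when only the arcs that start in `S` are kept, all other points
of `V` being fixed. -/
noncomputable def cutProd (ρ : ι → ι) (V S : Finset ι) (M : ℕ) : FractionRing ℤ[X] :=
  ∏ i ∈ V with ρ i ∉ S,
    qNum (if i ∈ S then hook ρ V i else M + (V.filter fun j => i ≤ j ∧ ρ j ∉ S).card)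

/-- The sets of arcs in `V` which contain with an arc all arcs enclosed by it; an arc is
represented by its first end point. -/
def lowerSets (ρ : ι → ι) (V : Finset ι) : Finset (Finset ι) :=
  V.powerset.filter fun S =>
    (∀ i ∈ S, i < ρ i) ∧ ∀ i ∈ S, ∀ j ∈ V, i < j → j < ρ i → j < ρ j → j ∈ S

/-- The first end points of the arcs in `V`. -/
def cups (ρ : ι → ι) (V : Finset ι) : Finset ι := V.filter fun i => i < ρ i

/-- The fixed points in `V`. -/
def bars (ρ : ι → ι) (V : Finset ι) : Finset ι := V.filter fun i => ρ i = i

theorem mem_lowerSets {ρ : ι → ι} {V S : Finset ι} : S ∈ lowerSets ρ V ↔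
    S ⊆ V ∧ (∀ i ∈ S, i < ρ i) ∧ ∀ i ∈ S, ∀ j ∈ V, i < j → j < ρ i → j < ρ j → j ∈ S := by
  simp [lowerSets]

theorem mem_cups {ρ : ι → ι} {V : Finset ι} {i : ι} : i ∈ cups ρ V ↔ i ∈ V ∧ i < ρ i := by
  simp [cups]

variable {ρ : ι → ι} (hρ : IsCupInvolution ρ)

theorem hook_congr {W W' : Finset ι} {i : ι}
    (h : ∀ j, i ≤ j → j ≤ ρ j → (ρ i = i ∨ ρ j ≤ ρ i) → (j ∈ W ↔ j ∈ W')) :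
    hook ρ W i = hook ρ W' i := by
  unfold hook
  congr 1
  ext j
  simp only [Finset.mem_filter]
  constructor
  · rintro ⟨h1, h2, h3, h4⟩; exact ⟨(h j h2 h3 h4).1 h1, h2, h3, h4⟩
  · rintro ⟨h1, h2, h3, h4⟩; exact ⟨(h j h2 h3 h4).2 h1, h2, h3, h4⟩

theorem hook_pos {W : Finset ι} {i : ι} (hi : i ∈ W) (h : i ≤ ρ i) : 0 < hook ρ W i :=
  Finset.card_pos.2 ⟨i, by simp [hi, h]⟩

theorem hookProd_ne_zero (W : Finset ι) (M : ℕ) : hookProd ρ W M ≠ 0 := by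
  refine Finset.prod_ne_zero_iff.2 fun i hi => qNum_ne_zero ?_
  rw [Finset.mem_filter] at hi
  have := hook_pos hi.1 hi.2
  omega

theorem cutProd_ne_zero {V S : Finset ι} (hS : ∀ i ∈ S, i < ρ i) (M : ℕ) :
    cutProd ρ V S M ≠ 0 := by
  refine Finset.prod_ne_zero_iff.2 fun i hi => qNum_ne_zero ?_
  rw [Finset.mem_filter] at hi
  split_ifs with h
  · exact hook_pos hi.1 (hS i h).le
  · have : 0 < (V.filter fun j => i ≤ j ∧ ρ j ∉ S).card :=
      Finset.card_pos.2 ⟨i, by simp [hi.1, hi.2]⟩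
    omega

theorem hookProd_congr {W W' : Finset ι} (h : ∀ j, j ≤ ρ j → (j ∈ W ↔ j ∈ W')) (M : ℕ) :
    hookProd ρ W M = hookProd ρ W' M := by
  unfold hookProd
  refine Finset.prod_congr ?_ fun i _ => ?_
  · ext j
    simp only [Finset.mem_filter]
    constructor
    · rintro ⟨h1, h2⟩; exact ⟨(h j h2).1 h1, h2⟩
    · rintro ⟨h1, h2⟩; exact ⟨(h j h2).2 h1, h2⟩
  · rw [hook_congr fun j _ h2 _ => h j h2]

theorem hookProd_eq_of_forall_ne {W : Finset ι} (h : ∀ i ∈ W, ρ i ≠ i) (M M' : ℕ) :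
    hookProd ρ W M = hookProd ρ W M' := by
  unfold hookProd
  refine Finset.prod_congr rfl fun i hi => ?_
  rw [if_neg (h i (Finset.mem_filter.1 hi).1), if_neg (h i (Finset.mem_filter.1 hi).1)]

theorem hookProd_insert {W : Finset ι} {i : ι} (h : ∀ j ∈ W, i < j) (hi : i ≤ ρ i) (M : ℕ) :
    hookProd ρ (insert i W) M
      = qNum (hook ρ (insert i W) i + if ρ i = i then M else 0) * hookProd ρ W M := by
  have hW : i ∉ W := fun h' => (h i h').false
  unfold hookProd
  rw [Finset.filter_insert, if_pos hi, Finset.prod_insert (by simp [hW])]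
  congr 1
  refine Finset.prod_congr rfl fun j hj => ?_
  have hj' := h j (Finset.mem_filter.1 hj).1
  rw [hook_congr fun l hl _ _ => ?_]
  have : l ≠ i := (hj'.trans_le hl).ne'
  simp [this]

theorem hookProd_union {A B : Finset ι} (h : ∀ a ∈ A, ∀ b ∈ B, a < b ∧ ρ a < b)
    (hA : ∀ a ∈ A, ρ a ≠ a) (M : ℕ) :
    hookProd ρ (A ∪ B) M = hookProd ρ A M * hookProd ρ B M := by
  have hd : Disjoint A B := Finset.disjoint_left.2 fun x hx hx' => (h x hx x hx').1.false
  unfold hookProd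
  rw [Finset.filter_union, Finset.prod_union (Finset.disjoint_filter_filter hd)]
  congr 1
  · refine Finset.prod_congr rfl fun a ha => ?_
    rw [Finset.mem_filter] at ha
    rw [hook_congr fun l hl hl' hl'' => ?_]
    have : l ∉ B := fun hlB =>
      absurd (hl'.trans (hl''.resolve_left (hA a ha.1))) (h a ha.1 l hlB).2.not_ge
    simp [this]
  · refine Finset.prod_congr rfl fun b hb => ?_
    rw [Finset.mem_filter] at hb
    rw [hook_congr fun l hl hl' hl'' => ?_]
    have : l ∉ A := fun hlA => absurd hl (h l hlA b hb.1).1.not_ge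
    simp [this]

include hρ in
-- If `S` consists of first end points, `ρ j ∉ S` says that `j` is not the far end of a kept arc, so
-- this is the number of lines after cutting.
theorem card_filter_notMem {V S : Finset ι} (hV : ∀ i ∈ V, ρ i ∈ V) (hS : S ⊆ V) :
    (V.filter fun j => ρ j ∉ S).card = V.card - S.card := by
  rw [← Finset.card_sdiff_of_subset hS]
  refine Finset.card_nbij' ρ ρ ?_ ?_ (fun i _ => hρ.invol i) (fun i _ => hρ.invol i)
  · intro i hi
    simp only [Finset.coe_filter, Set.mem_ofPred_eq, Finset.coe_sdiff, Set.mem_sdiff,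
      Finset.mem_coe] at hi ⊢
    exact ⟨hV i hi.1, hi.2⟩
  · intro i hi
    simp only [Finset.coe_filter, Set.mem_ofPred_eq, Finset.coe_sdiff, Set.mem_sdiff,
      Finset.mem_coe] at hi ⊢
    rw [hρ.invol]
    exact ⟨hV i hi.1, hi.2⟩

include hρ in
theorem card_eq_cups_add_bars {V : Finset ι} (hV : ∀ i ∈ V, ρ i ∈ V) :
    V.card = 2 * (cups ρ V).card + (bars ρ V).card := by
  have h1 : (V.filter fun i => ρ i < i).card = (cups ρ V).card := by
    refine Finset.card_nbij' ρ ρ ?_ ?_ (fun i _ => hρ.invol i) (fun i _ => hρ.invol i)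
    · intro i hi
      simp only [Finset.coe_filter, Set.mem_ofPred_eq, cups] at hi ⊢
      rw [hρ.invol]
      exact ⟨hV i hi.1, hi.2⟩
    · intro i hi
      simp only [Finset.coe_filter, Set.mem_ofPred_eq, cups] at hi ⊢
      rw [hρ.invol]
      exact ⟨hV i hi.1, hi.2⟩
  have h2 : V.card = (V.filter fun i => i < ρ i).card + (V.filter fun i => ¬ i < ρ i).card :=
    (Finset.card_filter_add_card_filter_not _).symm
  have h3 := Finset.card_filter_add_card_filter_not (s := V.filter fun i => ¬ i < ρ i)
    (fun i => ρ i < i)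
  rw [Finset.filter_filter, Finset.filter_filter] at h3
  have h4 : (V.filter fun i => ¬ i < ρ i ∧ ρ i < i) = V.filter fun i => ρ i < i := by
    refine Finset.filter_congr fun i _ => ⟨fun h => h.2, fun h => ⟨h.not_gt, h⟩⟩
  have h5 : (V.filter fun i => ¬ i < ρ i ∧ ¬ ρ i < i) = bars ρ V := by
    refine Finset.filter_congr fun i _ => ⟨fun h => le_antisymm (not_lt.1 h.1) (not_lt.1 h.2),
      fun h => by simp [h]⟩
  rw [h4, h5, h1] at h3
  rw [h2, ← h3]
  unfold cups
  ring

/-! ### Splitting at the first arc -/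

/-- A decomposition of `V` into a first arc, the set `A` of points enclosed by it, and the set `B`
of points which follow it. -/
structure CupSplit (ρ : ι → ι) (V A B : Finset ι) (i : ι) : Prop where
  eq_insert : V = insert i (insert (ρ i) (A ∪ B))
  lt : i < ρ i
  left : ∀ a ∈ A, i < a ∧ a < ρ i
  right : ∀ b ∈ B, ρ i < b
  closed_left : ∀ a ∈ A, ρ a ∈ A
  closed_right : ∀ b ∈ B, ρ b ∈ B
  left_ne : ∀ a ∈ A, ρ a ≠ a

include hρ in
theorem exists_cupSplit {V : Finset ι} (hV : ∀ i ∈ V, ρ i ∈ V) {i : ι} (hi : i ∈ V)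
    (hmin : ∀ j ∈ V, i ≤ j) (hlt : i < ρ i) : ∃ A B, CupSplit ρ V A B i := by
  refine ⟨V.filter fun x => i < x ∧ x < ρ i, V.filter fun x => ρ i < x, ?_, hlt, ?_, ?_, ?_, ?_, ?_⟩
  · ext x
    simp only [Finset.mem_insert, Finset.mem_union, Finset.mem_filter]
    constructor
    · intro hx
      rcases (hmin x hx).eq_or_lt with h | h
      · exact Or.inl h.symm
      · rcases lt_trichotomy x (ρ i) with h' | h' | h' <;> simp [*]
    · rintro (rfl | rfl | h | h)
      · exact hi
      · exact hV _ hi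
      · exact h.1
      · exact h.1
  · intro a ha; exact (Finset.mem_filter.1 ha).2
  · intro a ha; exact (Finset.mem_filter.1 ha).2
  · intro a ha
    simp only [Finset.mem_filter] at ha ⊢
    have := hρ.nest i a ha.2.1 ha.2.2
    exact ⟨hV _ ha.1, this.1, this.2.1⟩
  · intro b hb
    simp only [Finset.mem_filter] at hb ⊢
    refine ⟨hV _ hb.1, ?_⟩
    by_contra hcon
    rcases (not_lt.1 hcon).eq_or_lt with h | h
    · have h' : ρ (ρ b) = ρ (ρ i) := by rw [h]
      rw [hρ.invol, hρ.invol] at h'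
      exact absurd (hlt.trans hb.2) (by simp [h'])
    · rcases (hmin _ (hV _ hb.1)).eq_or_lt with h2 | h2
      · have h3 := hb.2
        rw [h2, hρ.invol] at h3
        exact h3.false
      · have h3 := (hρ.nest i _ h2 h).2.1
        rw [hρ.invol] at h3
        exact h3.not_gt hb.2
  · intro a ha
    simp only [Finset.mem_filter] at ha
    exact (hρ.nest i a ha.2.1 ha.2.2).2.2

namespace CupSplit

variable {V A B : Finset ι} {i : ι} (h : CupSplit ρ V A B i)

include h

theorem disjoint : Disjoint A B :=
  Finset.disjoint_left.2 fun x hx hx' => ((h.left x hx).2.trans (h.right x hx')).false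

theorem notMem_left : i ∉ A := fun h' => (h.left i h').1.false

theorem notMem_right : i ∉ B := fun h' => ((h.right i h').trans h.lt).false

theorem partner_notMem_left : ρ i ∉ A := fun h' => (h.left _ h').2.false

theorem partner_notMem_right : ρ i ∉ B := fun h' => (h.right _ h').false

theorem prod_filter {K : Type*} [CommMonoid K] (p : ι → Prop) [DecidablePred p] (f : ι → K) :
    ∏ x ∈ V with p x, f x = (if p i then f i else 1) * ((if p (ρ i) then f (ρ i) else 1) *
      ((∏ x ∈ A with p x, f x) * ∏ x ∈ B with p x, f x)) := by
  have h1 := h.notMem_left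
  have h2 := h.notMem_right
  have h3 := h.partner_notMem_left
  have h4 := h.partner_notMem_right
  rw [Finset.prod_filter, h.eq_insert, Finset.prod_insert (by simp [h1, h2, h.lt.ne]),
    Finset.prod_insert (by simp [h3, h4]), Finset.prod_union h.disjoint, Finset.prod_filter,
    Finset.prod_filter]

theorem card_filter (p : ι → Prop) [DecidablePred p] :
    (V.filter p).card = (if p i then 1 else 0) + ((if p (ρ i) then 1 else 0) +
      ((A.filter p).card + (B.filter p).card)) := by
  -- A cardinality is a product in `Multiplicative ℕ`.
  have h1 := h.prod_filter (K := Multiplicative ℕ) p (fun _ => Multiplicative.ofAdd 1)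
  simp only [Finset.card_eq_sum_ones]
  exact h1

theorem card : V.card = 2 + A.card + B.card := by
  have := h.card_filter (fun _ => True)
  simp at this
  omega

include hρ

theorem cups_card : (cups ρ V).card = 1 + (cups ρ A).card + (cups ρ B).card := by
  have := h.card_filter (fun i => i < ρ i)
  rw [if_pos h.lt, hρ.invol, if_neg h.lt.not_gt] at this
  simp only [cups]
  omega

theorem bars_card : (bars ρ V).card = (bars ρ B).card := by
  have := h.card_filter (fun i => ρ i = i)
  rw [if_neg h.lt.ne', hρ.invol, if_neg h.lt.ne] at this
  have h2 : (A.filter fun i => ρ i = i) = ∅ :=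
    Finset.filter_eq_empty_iff.2 fun {x} hx => h.left_ne x hx
  rw [h2] at this
  simp only [bars]
  simpa using this

/-- Far ends carry no hook, so `ρ i` contributes nothing, and the hook of `i` consists of `i` and
the cups of `A'`. Subsets are allowed in order to cover both `V` and `V \ S`. -/
theorem hookProd_eq {A' B' : Finset ι} (hA : A' ⊆ A) (hB : B' ⊆ B) (M : ℕ) :
    hookProd ρ (insert i (insert (ρ i) (A' ∪ B'))) M
      = qNum ((cups ρ A').card + 1) * hookProd ρ A' M * hookProd ρ B' M := by
  have hj : hookProd ρ (insert i (insert (ρ i) (A' ∪ B'))) M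
      = hookProd ρ (insert i (A' ∪ B')) M := by
    refine hookProd_congr (fun j hj => ?_) M
    have : j ≠ ρ i := by rintro rfl; rw [hρ.invol] at hj; exact hj.not_gt h.lt
    simp [this]
  have hlt : ∀ j ∈ A' ∪ B', i < j := by
    intro j hj
    rcases Finset.mem_union.1 hj with hj | hj
    · exact (h.left j (hA hj)).1
    · exact h.lt.trans (h.right j (hB hj))
  rw [hj, hookProd_insert hlt h.lt.le, if_neg h.lt.ne', add_zero, hookProd_union, mul_assoc]
  · congr 2
    have : (insert i (A' ∪ B')).filter (fun j => i ≤ j ∧ j ≤ ρ j ∧ (ρ i = i ∨ ρ j ≤ ρ i))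
        = insert i (cups ρ A') := by
      ext x
      simp only [Finset.mem_filter, Finset.mem_insert, Finset.mem_union, mem_cups, h.lt.ne',
        false_or]
      constructor
      · rintro ⟨rfl | hx | hx, h1, h2, h3⟩
        · exact Or.inl rfl
        · exact Or.inr ⟨hx, lt_of_le_of_ne h2 (h.left_ne x (hA hx)).symm⟩
        · exact absurd (h2.trans h3) (h.right x (hB hx)).not_ge
      · rintro (rfl | ⟨hx, hx'⟩)
        · exact ⟨Or.inl rfl, le_rfl, h.lt.le, le_rfl⟩
        · exact ⟨Or.inr (Or.inl hx), (h.left x (hA hx)).1.le, hx'.le,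
            (h.left _ (h.closed_left x (hA hx))).2.le⟩
    rw [hook, this, Finset.card_insert_of_notMem]
    exact fun hi => h.notMem_left (hA (mem_cups.1 hi).1)
  · intro a ha b hb
    have hb' := h.right b (hB hb)
    exact ⟨(h.left a (hA ha)).2.trans hb', (h.left _ (h.closed_left a (hA ha))).2.trans hb'⟩
  · exact fun a ha => h.left_ne a (hA ha)

omit hρ in
theorem hook_of_mem_left {a : ι} (ha : a ∈ A) (ha' : a < ρ a) : hook ρ V a = hook ρ A a := by
  refine hook_congr fun j h1 h2 h3 => ?_
  have h4 := h3.resolve_left ha'.ne'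
  have h5 := h.left a ha
  have h6 := h.left _ (h.closed_left a ha)
  have h7 : j ≠ i := (h5.1.trans_le h1).ne'
  have h8 : j ≠ ρ i := ((h2.trans h4).trans_lt h6.2).ne
  have h9 : j ∉ B := fun hj => ((h.right j hj).trans_le (h2.trans h4)).not_gt h6.2
  rw [h.eq_insert]
  simp [h7, h8, h9]

omit hρ in
theorem hook_of_mem_right {b : ι} (hb : b ∈ B) : hook ρ V b = hook ρ B b := by
  refine hook_congr fun j h1 h2 h3 => ?_
  have h5 := (h.right b hb).trans_le h1
  have h7 : j ≠ i := (h.lt.trans h5).ne'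
  have h9 : j ∉ A := fun hj => (h.left j hj).2.not_gt h5
  rw [h.eq_insert]
  simp [h7, h5.ne', h9]

/-- The arc at `i` is cut, and the two leading factors are the hooks of its ends. For a fixed point
in `A`, the lines further below now include those of `B` and the end `ρ i`, which gives the new
parameter; `B` does not notice the cut. -/
theorem cutProd_union {S T : Finset ι} (hS : S ∈ lowerSets ρ A) (hT : T ∈ lowerSets ρ B) (M : ℕ) :
    cutProd ρ V (S ∪ T) M = qNum (M + (B.card - T.card) + 1 + (A.card - S.card) + 1)
      * qNum (M + (B.card - T.card) + 1)
      * cutProd ρ A S (M + (B.card - T.card) + 1) * cutProd ρ B T M := by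
  rw [mem_lowerSets] at hS hT
  have hi : i ∉ S ∪ T := by
    simp only [Finset.mem_union, not_or]
    exact ⟨fun h' => h.notMem_left (hS.1 h'), fun h' => h.notMem_right (hT.1 h')⟩
  have hj : ρ i ∉ S ∪ T := by
    simp only [Finset.mem_union, not_or]
    exact ⟨fun h' => h.partner_notMem_left (hS.1 h'), fun h' => h.partner_notMem_right (hT.1 h')⟩
  have hA : ∀ a ∈ A, (a ∈ S ∪ T ↔ a ∈ S) := by
    intro a ha
    have : a ∉ T := fun h' => Finset.disjoint_left.1 h.disjoint ha (hT.1 h')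
    simp [this]
  have hB : ∀ b ∈ B, (b ∈ S ∪ T ↔ b ∈ T) := by
    intro b hb
    have : b ∉ S := fun h' => Finset.disjoint_left.1 h.disjoint (hS.1 h') hb
    simp [this]
  have hA' : ∀ a ∈ A, (ρ a ∈ S ∪ T ↔ ρ a ∈ S) := fun a ha => hA _ (h.closed_left a ha)
  have hB' : ∀ b ∈ B, (ρ b ∈ S ∪ T ↔ ρ b ∈ T) := fun b hb => hB _ (h.closed_right b hb)
  have cA := card_filter_notMem hρ h.closed_left hS.1
  have cB := card_filter_notMem hρ h.closed_right hT.1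
  have e1 : (V.filter fun l => i ≤ l ∧ ρ l ∉ S ∪ T).card
      = 2 + (A.card - S.card) + (B.card - T.card) := by
    rw [h.card_filter, if_pos ⟨le_rfl, hj⟩, hρ.invol, if_pos ⟨h.lt.le, hi⟩, ← cA, ← cB,
      Finset.filter_congr (s := A) fun a ha => (?_ : _ ↔ ρ a ∉ S),
      Finset.filter_congr (s := B) fun b hb => (?_ : _ ↔ ρ b ∉ T)]
    · ring
    · rw [hB' b hb]; exact and_iff_right (h.lt.trans (h.right b hb)).le
    · rw [hA' a ha]; exact and_iff_right (h.left a ha).1.le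
  have e2 : (V.filter fun l => ρ i ≤ l ∧ ρ l ∉ S ∪ T).card = 1 + (B.card - T.card) := by
    rw [h.card_filter, if_neg (fun h' => h'.1.not_gt h.lt), hρ.invol, if_pos ⟨le_rfl, hi⟩, ← cB,
      Finset.filter_congr (s := B) fun b hb => (?_ : _ ↔ ρ b ∉ T),
      (Finset.filter_eq_empty_iff (s := A)).2 fun {a} ha h' => ?_]
    · simp
    · exact h'.1.not_gt (h.left a ha).2
    · rw [hB' b hb]; exact and_iff_right (h.right b hb).le
  rw [cutProd, h.prod_filter, if_pos hj, if_neg hi, hρ.invol, if_pos hi, if_neg hj, e1, e2,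
    ← mul_assoc, ← mul_assoc]
  refine congrArg₂ _ (congrArg₂ _ ?_ ?_) ?_
  · congr 2 <;> ring
  · rw [cutProd, Finset.filter_congr (s := A) fun a ha => (?_ : _ ↔ ρ a ∉ S)]
    · refine Finset.prod_congr rfl fun a ha => ?_
      have ha := (Finset.mem_filter.1 ha).1
      by_cases haS : a ∈ S
      · rw [if_pos ((hA a ha).2 haS), if_pos haS, h.hook_of_mem_left ha (hS.2.1 a haS)]
      · rw [if_neg (fun h' => haS ((hA a ha).1 h')), if_neg haS, h.card_filter,
          if_neg (fun h' => h'.1.not_gt (h.left a ha).1), hρ.invol,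
          if_pos ⟨(h.left a ha).2.le, hi⟩, ← cB,
          Finset.filter_congr (s := A) fun x hx => (?_ : _ ↔ a ≤ x ∧ ρ x ∉ S),
          Finset.filter_congr (s := B) fun x hx => (?_ : _ ↔ ρ x ∉ T)]
        · congr 1; ring
        · rw [hB' x hx]; exact and_iff_right ((h.left a ha).2.trans (h.right x hx)).le
        · rw [hA' x hx]
    · rw [hA' a ha]
  · rw [cutProd, Finset.filter_congr (s := B) fun b hb => (?_ : _ ↔ ρ b ∉ T)]
    · refine Finset.prod_congr rfl fun b hb => ?_
      have hb := (Finset.mem_filter.1 hb).1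
      have hlt := h.right b hb
      by_cases hbT : b ∈ T
      · rw [if_pos ((hB b hb).2 hbT), if_pos hbT, h.hook_of_mem_right hb]
      · rw [if_neg (fun h' => hbT ((hB b hb).1 h')), if_neg hbT, h.card_filter,
          if_neg (fun h' => h'.1.not_gt (h.lt.trans hlt)), if_neg (fun h' => h'.1.not_gt hlt),
          (Finset.filter_eq_empty_iff (s := A)).2 fun {a} ha h' => ?_,
          Finset.filter_congr (s := B) fun x hx => (?_ : _ ↔ b ≤ x ∧ ρ x ∉ T)]
        · simp
        · rw [hB' x hx]
        · exact h'.1.not_gt ((h.left a ha).2.trans hlt)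
    · rw [hB' b hb]

theorem hookProd_sdiff_union {S T : Finset ι} (hS : S ∈ lowerSets ρ A) (hT : T ∈ lowerSets ρ B)
    (M M' : ℕ) :
    hookProd ρ (V \ (S ∪ T)) M = qNum ((cups ρ A).card - S.card + 1) * hookProd ρ (A \ S) M'
      * hookProd ρ (B \ T) M := by
  rw [mem_lowerSets] at hS hT
  have e : V \ (S ∪ T) = insert i (insert (ρ i) ((A \ S) ∪ (B \ T))) := by
    have h1 := h.notMem_left
    have h2 := h.notMem_right
    have h3 := h.partner_notMem_left
    have h4 := h.partner_notMem_right
    have h5 := h.disjoint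
    rw [h.eq_insert]
    ext x
    have h6 : x ∈ A → x ∉ B := fun hx => Finset.disjoint_left.1 h5 hx
    have h7 : x ∈ S → x ∈ A := fun hx => hS.1 hx
    have h8 : x ∈ T → x ∈ B := fun hx => hT.1 hx
    simp only [Finset.mem_sdiff, Finset.mem_insert, Finset.mem_union]
    by_cases hi : x = i
    · subst hi; tauto
    · by_cases hj : x = ρ i
      · subst hj; tauto
      · tauto
  have e2 : cups ρ (A \ S) = cups ρ A \ S := by
    ext x
    simp only [mem_cups, Finset.mem_sdiff]
    tauto
  rw [e, h.hookProd_eq hρ Finset.sdiff_subset Finset.sdiff_subset, e2,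
    Finset.card_sdiff_of_subset fun x hx => mem_cups.2 ⟨hS.1 hx, hS.2.1 x hx⟩,
    hookProd_eq_of_forall_ne (fun a ha => h.left_ne a (Finset.mem_sdiff.1 ha).1) M M']

theorem hookProd_eq' (M M' : ℕ) :
    hookProd ρ V M = qNum ((cups ρ A).card + 1) * hookProd ρ A M' * hookProd ρ B M := by
  rw [hookProd_eq_of_forall_ne h.left_ne M' M,
    ← h.hookProd_eq hρ (Finset.Subset.refl A) (Finset.Subset.refl B), ← h.eq_insert]

/-- The arc at `i` is kept together with all arcs in `A`, which retain their hooks. The value of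
`M'` is immaterial because `A` has no fixed points. -/
theorem cutProd_insert {T : Finset ι} (hT : T ∈ lowerSets ρ B) (M M' : ℕ) :
    cutProd ρ V (insert i (cups ρ A ∪ T)) M
      = qNum ((cups ρ A).card + 1) * hookProd ρ A M' * cutProd ρ B T M := by
  rw [mem_lowerSets] at hT
  have hj : ρ i ∉ insert i (cups ρ A ∪ T) := by
    simp only [Finset.mem_insert, Finset.mem_union, not_or, mem_cups]
    exact ⟨h.lt.ne', fun h' => h.partner_notMem_left h'.1,
      fun h' => h.partner_notMem_right (hT.1 h')⟩
  have hA : ∀ a ∈ A, (a ∈ insert i (cups ρ A ∪ T) ↔ a < ρ a) := by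
    intro a ha
    have h1 : a ∉ T := fun h' => Finset.disjoint_left.1 h.disjoint ha (hT.1 h')
    have h2 : a ≠ i := (h.left a ha).1.ne'
    simp [h1, h2, mem_cups, ha]
  have hB : ∀ b ∈ B, (b ∈ insert i (cups ρ A ∪ T) ↔ b ∈ T) := by
    intro b hb
    have h1 : b ∉ A := fun h' => Finset.disjoint_left.1 h.disjoint h' hb
    have h2 : b ≠ i := (h.lt.trans (h.right b hb)).ne'
    simp [h1, h2, mem_cups]
  have hA' : ∀ a ∈ A, (ρ a ∈ insert i (cups ρ A ∪ T) ↔ ρ a < a) := fun a ha => by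
    rw [hA _ (h.closed_left a ha), hρ.invol]
  have hB' : ∀ b ∈ B, (ρ b ∈ insert i (cups ρ A ∪ T) ↔ ρ b ∈ T) :=
    fun b hb => hB _ (h.closed_right b hb)
  have ei : hook ρ V i = (cups ρ A).card + 1 := by
    have : (B.filter fun j => i ≤ j ∧ j ≤ ρ j ∧ (ρ i = i ∨ ρ j ≤ ρ i)) = ∅ := by
      refine Finset.filter_eq_empty_iff.2 fun {b} hb h' => ?_
      exact ((h.right b hb).trans_le h'.2.1).not_ge (h'.2.2.resolve_left h.lt.ne')
    rw [hook, h.card_filter, if_pos ⟨le_rfl, h.lt.le, Or.inr le_rfl⟩, this, hρ.invol,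
      if_neg (fun h' => h'.2.1.not_gt h.lt), cups,
      Finset.filter_congr (s := A) fun a ha => (?_ : _ ↔ a < ρ a)]
    · simp [add_comm]
    · constructor
      · exact fun h' => lt_of_le_of_ne h'.2.1 (h.left_ne a ha).symm
      · exact fun h' => ⟨(h.left a ha).1.le, h'.le, Or.inr (h.left _ (h.closed_left a ha)).2.le⟩
  rw [cutProd, h.prod_filter, if_pos hj, if_pos (Finset.mem_insert_self _ _), hρ.invol,
    if_neg (fun h' => h' (Finset.mem_insert_self _ _)), ei, one_mul, ← mul_assoc]
  refine congrArg₂ _ (congrArg₂ _ rfl ?_) ?_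
  · rw [hookProd, Finset.filter_congr (s := A) fun a ha => (?_ : _ ↔ a ≤ ρ a)]
    · refine Finset.prod_congr rfl fun a ha => ?_
      rw [Finset.mem_filter] at ha
      have hlt := lt_of_le_of_ne ha.2 (h.left_ne a ha.1).symm
      rw [if_pos ((hA a ha.1).2 hlt), h.hook_of_mem_left ha.1 hlt, if_neg hlt.ne', add_zero]
    · rw [hA' a ha, not_lt]
  · rw [cutProd, Finset.filter_congr (s := B) fun b hb => (?_ : _ ↔ ρ b ∉ T)]
    · refine Finset.prod_congr rfl fun b hb => ?_
      have hb := (Finset.mem_filter.1 hb).1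
      have hlt := h.right b hb
      by_cases hbT : b ∈ T
      · rw [if_pos ((hB b hb).2 hbT), if_pos hbT, h.hook_of_mem_right hb]
      · rw [if_neg (fun h' => hbT ((hB b hb).1 h')), if_neg hbT, h.card_filter,
          if_neg (fun h' => h'.1.not_gt (h.lt.trans hlt)), if_neg (fun h' => h'.1.not_gt hlt),
          (Finset.filter_eq_empty_iff (s := A)).2 fun {a} ha h' => ?_,
          Finset.filter_congr (s := B) fun x hx => (?_ : _ ↔ b ≤ x ∧ ρ x ∉ T)]
        · simp
        · rw [hB' x hx]
        · exact h'.1.not_gt ((h.left a ha).2.trans hlt)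
    · rw [hB' b hb]

theorem hookProd_sdiff_insert {T : Finset ι} (hT : T ∈ lowerSets ρ B) (M : ℕ) :
    hookProd ρ (V \ insert i (cups ρ A ∪ T)) M = hookProd ρ (B \ T) M := by
  rw [mem_lowerSets] at hT
  refine hookProd_congr (fun x hx => ?_) M
  rw [h.eq_insert]
  simp only [Finset.mem_sdiff, Finset.mem_insert, Finset.mem_union, mem_cups]
  have h0 : x ≠ ρ i := by rintro rfl; rw [hρ.invol] at hx; exact hx.not_gt h.lt
  have h1 : x ∈ B → x ≠ i := by rintro hb rfl; exact h.notMem_right hb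
  have h2 : x ∈ A → x < ρ x := fun ha => lt_of_le_of_ne hx (h.left_ne x ha).symm
  have h3 : x ∈ B → x ∉ A := fun hb ha => Finset.disjoint_left.1 h.disjoint ha hb
  tauto

/-- A lower set that contains `i` contains all cups of `A` and is determined by its trace on `B`;
one without `i` is a union of arbitrary lower sets of `A` and `B`. -/
theorem sum_lowerSets {K : Type*} [AddCommMonoid K] (F : Finset ι → K) :
    ∑ S ∈ lowerSets ρ V, F S = ∑ T ∈ lowerSets ρ B,
      (F (insert i (cups ρ A ∪ T)) + ∑ S ∈ lowerSets ρ A, F (S ∪ T)) := by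
  have hAV : A ⊆ V := fun x hx => by rw [h.eq_insert]; simp [hx]
  have hBV : B ⊆ V := fun x hx => by rw [h.eq_insert]; simp [hx]
  have hiV : i ∈ V := by rw [h.eq_insert]; simp
  have hV : ∀ x ∈ V, x = i ∨ x = ρ i ∨ x ∈ A ∨ x ∈ B := fun x hx => by
    rw [h.eq_insert] at hx; simpa using hx
  have hjS : ∀ S ∈ lowerSets ρ V, ρ i ∉ S := by
    intro S hS hj
    have := (mem_lowerSets.1 hS).2.1 _ hj
    rw [hρ.invol] at this
    exact this.not_gt h.lt
  have hres : ∀ S ∈ lowerSets ρ V, S ∩ A ∈ lowerSets ρ A ∧ S ∩ B ∈ lowerSets ρ B := by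
    intro S hS
    simp only [mem_lowerSets] at hS ⊢
    refine ⟨⟨Finset.inter_subset_right, fun x hx => hS.2.1 x (Finset.mem_inter.1 hx).1, ?_⟩,
      ⟨Finset.inter_subset_right, fun x hx => hS.2.1 x (Finset.mem_inter.1 hx).1, ?_⟩⟩
    · intro x hx y hy h1 h2 h3
      exact Finset.mem_inter.2 ⟨hS.2.2 x (Finset.mem_inter.1 hx).1 y (hAV hy) h1 h2 h3, hy⟩
    · intro x hx y hy h1 h2 h3
      exact Finset.mem_inter.2 ⟨hS.2.2 x (Finset.mem_inter.1 hx).1 y (hBV hy) h1 h2 h3, hy⟩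
  rw [Finset.sum_add_distrib, ← Finset.sum_product' (lowerSets ρ B) (lowerSets ρ A)
      (fun T S => F (S ∪ T)),
    ← Finset.sum_filter_add_sum_filter_not (lowerSets ρ V) (fun S => i ∈ S)]
  congr 1
  · symm
    refine Finset.sum_nbij' (fun T => insert i (cups ρ A ∪ T)) (fun S => S ∩ B) ?_ ?_ ?_ ?_ ?_
    · intro T hT
      rw [mem_lowerSets] at hT
      rw [Finset.mem_filter, mem_lowerSets]
      refine ⟨⟨?_, ?_, ?_⟩, Finset.mem_insert_self _ _⟩
      · intro x hx
        simp only [Finset.mem_insert, Finset.mem_union, mem_cups] at hx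
        rcases hx with rfl | hx | hx
        · exact hiV
        · exact hAV hx.1
        · exact hBV (hT.1 hx)
      · intro x hx
        simp only [Finset.mem_insert, Finset.mem_union, mem_cups] at hx
        rcases hx with rfl | hx | hx
        · exact h.lt
        · exact hx.2
        · exact hT.2.1 x hx
      · intro x hx y hy h1 h2 h3
        simp only [Finset.mem_insert, Finset.mem_union, mem_cups] at hx ⊢
        rcases hV y hy with rfl | rfl | hy | hy
        · exact Or.inl rfl
        · rw [hρ.invol] at h3
          exact absurd h3 h.lt.not_gt
        · exact Or.inr (Or.inl ⟨hy, h3⟩)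
        · refine Or.inr (Or.inr ?_)
          rcases hx with rfl | hx | hx
          · exact absurd h2 (h.right y hy).not_gt
          · exact absurd (h2.trans (h.left _ (h.closed_left x hx.1)).2) (h.right y hy).not_gt
          · exact hT.2.2 x hx y hy h1 h2 h3
    · intro S hS
      exact (hres S (Finset.mem_filter.1 hS).1).2
    · intro T hT
      rw [mem_lowerSets] at hT
      ext x
      simp only [Finset.mem_inter, Finset.mem_insert, Finset.mem_union, mem_cups]
      have h1 : x ∈ B → x ≠ i := by rintro hb rfl; exact h.notMem_right hb
      have h3 : x ∈ B → x ∉ A := fun hb ha => Finset.disjoint_left.1 h.disjoint ha hb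
      have h4 := @hT.1 x
      tauto
    · intro S hS
      rw [Finset.mem_filter] at hS
      have hj := hjS S hS.1
      have hS' := mem_lowerSets.1 hS.1
      ext x
      simp only [Finset.mem_inter, Finset.mem_insert, Finset.mem_union, mem_cups]
      constructor
      · rintro (rfl | hx | hx)
        · exact hS.2
        · exact hS'.2.2 i hS.2 x (hAV hx.1) (h.left x hx.1).1 (h.left x hx.1).2 hx.2
        · exact hx.1
      · intro hx
        rcases hV x (hS'.1 hx) with rfl | rfl | hx' | hx'
        · exact Or.inl rfl
        · exact absurd hx hj
        · exact Or.inr (Or.inl ⟨hx', hS'.2.1 x hx⟩)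
        · exact Or.inr (Or.inr ⟨hx, hx'⟩)
    · intro T _; rfl
  · symm
    refine Finset.sum_nbij' (fun p => p.2 ∪ p.1) (fun S => (S ∩ B, S ∩ A)) ?_ ?_ ?_ ?_ ?_
    · rintro ⟨T, S⟩ hp
      rw [Finset.mem_product, mem_lowerSets, mem_lowerSets] at hp
      obtain ⟨hT, hS⟩ := hp
      dsimp only at hT hS ⊢
      rw [Finset.mem_filter, mem_lowerSets]
      refine ⟨⟨?_, ?_, ?_⟩, ?_⟩
      · exact Finset.union_subset (hS.1.trans hAV) (hT.1.trans hBV)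
      · intro x hx
        rcases Finset.mem_union.1 hx with hx | hx
        · exact hS.2.1 x hx
        · exact hT.2.1 x hx
      · intro x hx y hy h1 h2 h3
        rcases Finset.mem_union.1 hx with hx | hx
        · have a1 := h.left x (hS.1 hx)
          have a2 := h.left _ (h.closed_left x (hS.1 hx))
          rcases hV y hy with rfl | rfl | hy | hy
          · exact absurd h1 a1.1.not_gt
          · exact absurd h2 a2.2.not_gt
          · exact Finset.mem_union_left _ (hS.2.2 x hx y hy h1 h2 h3)
          · exact absurd (h2.trans a2.2) (h.right y hy).not_gt
        · have a1 := (h.right x (hT.1 hx)).trans h1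
          rcases hV y hy with rfl | rfl | hy | hy
          · exact absurd a1 h.lt.not_gt
          · exact absurd a1 (lt_irrefl _)
          · exact absurd a1 (h.left y hy).2.not_gt
          · exact Finset.mem_union_right _ (hT.2.2 x hx y hy h1 h2 h3)
      · rw [Finset.mem_union, not_or]
        exact ⟨fun h' => h.notMem_left (hS.1 h'), fun h' => h.notMem_right (hT.1 h')⟩
    · intro S hS
      have := hres S (Finset.mem_filter.1 hS).1
      exact Finset.mem_product.2 ⟨this.2, this.1⟩
    · rintro ⟨T, S⟩ hp
      rw [Finset.mem_product, mem_lowerSets, mem_lowerSets] at hp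
      obtain ⟨hT, hS⟩ := hp
      dsimp only at hT hS ⊢
      ext x
      all_goals
        have h3 : x ∈ B → x ∉ A := fun hb ha => Finset.disjoint_left.1 h.disjoint ha hb
        have h4 := @hT.1 x
        have h5 := @hS.1 x
        simp only [Finset.mem_inter, Finset.mem_union]
        tauto
    · intro S hS
      rw [Finset.mem_filter] at hS
      have hj := hjS S hS.1
      have hS' := mem_lowerSets.1 hS.1
      ext x
      simp only [Finset.mem_inter, Finset.mem_union]
      constructor
      · rintro (hx | hx)
        · exact hx.1
        · exact hx.1
      · intro hx
        rcases hV x (hS'.1 hx) with rfl | rfl | hx' | hx'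
        · exact absurd hx hS.2
        · exact absurd hx hj
        · exact Or.inl ⟨hx, hx'⟩
        · exact Or.inr ⟨hx, hx'⟩
    · rintro ⟨T, S⟩ _; rfl

end CupSplit

/-! ### The weighted sum over lower sets -/

/-- The quantity to be summed in `sum_lowerSets_eq`. -/
noncomputable def cutTerm (ρ : ι → ι) (V : Finset ι) (M : ℕ) (ψ : ℕ → FractionRing ℤ[X])
    (S : Finset ι) : FractionRing ℤ[X] :=
  ψ (M + (V.card - S.card)) / (cutProd ρ V S M * hookProd ρ (V \ S) M)

include hρ in
-- The first arc and the `n` arcs enclosed by it act on the rest as `T^(n+1)`. For fixed `T`, the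
-- lower sets with and without `i` yield the two summands of `transfer_iterate_succ_eq_nest` at `N =
-- M + (|B| - |T|)`.
theorem CupSplit.sum_cutTerm {V A B : Finset ι} {i : ι} (h : CupSplit ρ V A B i) (M : ℕ)
    (ψ : ℕ → FractionRing ℤ[X])
    (hA : ∀ M ψ, ∑ S ∈ lowerSets ρ A, cutTerm ρ A M ψ S
      = transfer^[(cups ρ A).card] ψ M / hookProd ρ A 0) :
    ∑ S ∈ lowerSets ρ V, cutTerm ρ V M ψ S
      = ∑ T ∈ lowerSets ρ B, cutTerm ρ B M (transfer^[(cups ρ A).card + 1] ψ) T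
        / (qNum ((cups ρ A).card + 1) * hookProd ρ A 0) := by
  rw [h.sum_lowerSets hρ]
  refine Finset.sum_congr rfl fun T hT => ?_
  have hTB := (mem_lowerSets.1 hT).1
  have hTc := Finset.card_le_card hTB
  have hAc : A.card = 2 * (cups ρ A).card := by
    rw [card_eq_cups_add_bars hρ h.closed_left, bars,
      Finset.filter_eq_empty_iff.2 fun {a} ha => h.left_ne a ha]
    rfl
  have hAB : Disjoint (cups ρ A) T := by
    refine Finset.disjoint_left.2 fun x hx hx' => ?_
    exact Finset.disjoint_left.1 h.disjoint (mem_cups.1 hx).1 (hTB hx')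
  have hVc := h.card
  set n := (cups ρ A).card with hn
  set N := M + (B.card - T.card) with hN
  have hq := qNum_succ_ne_zero
  have e1 : cutTerm ρ V M ψ (insert i (cups ρ A ∪ T)) = ψ (N + n + 1)
      / (cutProd ρ B T M * hookProd ρ (B \ T) M * (qNum (n + 1) * hookProd ρ A 0)) := by
    have hc : (insert i (cups ρ A ∪ T)).card = 1 + n + T.card := by
      rw [Finset.card_insert_of_notMem, Finset.card_union_of_disjoint hAB]
      · ring
      · rw [Finset.mem_union, not_or]
        exact ⟨fun h' => h.notMem_left (mem_cups.1 h').1, fun h' => h.notMem_right (hTB h')⟩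
    rw [cutTerm, hc, h.cutProd_insert hρ hT M 0, h.hookProd_sdiff_insert hρ hT,
      show M + (V.card - (1 + n + T.card)) = N + n + 1 by omega]
    congr 1
    ring
  -- At `s = N + 1 + (|A| - |S|)` with `|A| = 2n`, the number `s - N - n` is the hook `n - |S| + 1`
  -- of the arc at `i` in the right factor.
  have e2 : ∀ S ∈ lowerSets ρ A, cutTerm ρ V M ψ (S ∪ T)
      = cutTerm ρ A (N + 1) (fun s => ψ (s + 1) / (qNum (s + 1) * qNum (s - N - n))) S
        / (cutProd ρ B T M * hookProd ρ (B \ T) M * qNum (N + 1)) := by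
    intro S hS
    have hSA := (mem_lowerSets.1 hS).1
    have hSc := Finset.card_le_card hSA
    have hSn : S.card ≤ n :=
      Finset.card_le_card fun x hx => mem_cups.2 ⟨hSA hx, (mem_lowerSets.1 hS).2.1 x hx⟩
    have hd : Disjoint S T := Finset.disjoint_of_subset_left hSA
      (Finset.disjoint_of_subset_right hTB h.disjoint)
    rw [cutTerm, cutTerm, Finset.card_union_of_disjoint hd, h.cutProd_union hρ hS hT,
      h.hookProd_sdiff_union hρ hS hT M (N + 1), ← hn, ← hN,
      show M + (V.card - (S.card + T.card)) = N + 1 + (A.card - S.card) + 1 by omega,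
      show N + 1 + (A.card - S.card) - N - n = n - S.card + 1 by omega,
      div_div, div_div]
    congr 1
    ring
  rw [e1, Finset.sum_congr rfl e2, ← Finset.sum_div, hA, cutTerm, ← hN,
    transfer_iterate_succ_eq_nest]
  have h1 := cutProd_ne_zero (V := B) (mem_lowerSets.1 hT).2.1 M
  have h2 := hookProd_ne_zero (ρ := ρ) (B \ T) M
  have h3 := hookProd_ne_zero (ρ := ρ) A 0
  have h4 := hq n
  have h5 := hq N
  generalize transfer^[n] _ _ = Y
  field_simp

theorem lowerSets_insert_bar {V : Finset ι} {i : ι} (hi : ρ i = i) (hV : ∀ j ∈ V, i < j) :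
    lowerSets ρ (insert i V) = lowerSets ρ V := by
  ext S
  simp only [mem_lowerSets]
  constructor
  · rintro ⟨h1, h2, h3⟩
    refine ⟨fun x hx => ?_, h2, fun x hx y hy => h3 x hx y (Finset.mem_insert_of_mem hy)⟩
    rcases Finset.mem_insert.1 (h1 hx) with rfl | h
    · exact absurd hi (h2 _ hx).ne'
    · exact h
  · rintro ⟨h1, h2, h3⟩
    refine ⟨h1.trans (Finset.subset_insert _ _), h2, fun x hx y hy h4 => ?_⟩
    rcases Finset.mem_insert.1 hy with rfl | h
    · exact absurd h4 (hV x (h1 hx)).not_gt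
    · exact h3 x hx y h h4

include hρ in
-- The new fixed point encloses everything, so its hook in the left factor is `s + 1` for `s = M +
-- (|V| - |S|)`. In the right factor it encloses one line less for each cup of `V`, because `|V|`
-- counts every cup twice.
theorem cutTerm_insert_bar {V S : Finset ι} {i : ι} (hi : ρ i = i) (hV : ∀ j ∈ V, i < j)
    (hcV : ∀ j ∈ V, ρ j ∈ V) (hS : S ∈ lowerSets ρ V) (M : ℕ) (ψ : ℕ → FractionRing ℤ[X]) :
    cutTerm ρ (insert i V) M ψ S = cutTerm ρ V M
      (fun s => ψ (s + 1) / (qNum (s + 1) * qNum (s + 1 - (cups ρ V).card))) S := by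
  rw [mem_lowerSets] at hS
  have hiV : i ∉ V := fun h => (hV i h).false
  have hiS : i ∉ S := fun h => hiV (hS.1 h)
  have hSc := Finset.card_le_card hS.1
  have hVc := card_eq_cups_add_bars hρ hcV
  have hSn : S.card ≤ (cups ρ V).card :=
      Finset.card_le_card fun x hx => mem_cups.2 ⟨hS.1 hx, hS.2.1 x hx⟩
  have cV := card_filter_notMem hρ hcV hS.1
  have e1 : cutProd ρ (insert i V) S M
      = qNum (M + (V.card - S.card) + 1) * cutProd ρ V S M := by
    unfold cutProd
    rw [Finset.filter_insert, hi, if_pos hiS, Finset.prod_insert (by simp [hiV]), if_neg hiS,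
      Finset.filter_insert, hi, if_pos ⟨le_rfl, hiS⟩, Finset.card_insert_of_notMem (by simp [hiV]),
      Finset.filter_congr (s := V) fun x hx => (?_ : i ≤ x ∧ ρ x ∉ S ↔ ρ x ∉ S), cV]
    · refine congrArg₂ _ rfl (Finset.prod_congr rfl fun j hj => ?_)
      have hj' := hV j (Finset.mem_filter.1 hj).1
      rw [Finset.filter_insert, if_neg (show ¬ (j ≤ i ∧ ρ i ∉ S) from fun h => h.1.not_gt hj'),
        hook_congr fun l hl _ _ => ?_]
      simp [(hj'.trans_le hl).ne']
    · exact and_iff_right (hV x hx).le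
  have e2 : hookProd ρ (insert i V \ S) M
      = qNum (M + (V.card - S.card) + 1 - (cups ρ V).card) * hookProd ρ (V \ S) M := by
    rw [Finset.insert_sdiff_of_notMem _ hiS,
      hookProd_insert (fun j hj => hV j (Finset.mem_sdiff.1 hj).1) hi.ge, if_pos hi]
    congr 2
    have h1 : (insert i (V \ S)).filter (fun j => i ≤ j ∧ j ≤ ρ j ∧ (ρ i = i ∨ ρ j ≤ ρ i))
        = insert i ((cups ρ V \ S) ∪ bars ρ V) := by
      ext x
      have h1 : x ∈ S → x < ρ x := fun hx => hS.2.1 x hx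
      have h2 : x ∈ V → i ≤ x := fun hx => (hV x hx).le
      simp only [Finset.mem_filter, Finset.mem_insert, Finset.mem_sdiff, Finset.mem_union,
        mem_cups, bars, hi, true_or, and_true]
      constructor
      · rintro ⟨rfl | hx, -, h3⟩
        · exact Or.inl rfl
        · rcases h3.eq_or_lt with h4 | h4
          · exact Or.inr (Or.inr ⟨hx.1, h4.symm⟩)
          · exact Or.inr (Or.inl ⟨⟨hx.1, h4⟩, hx.2⟩)
      · rintro (rfl | hx | hx)
        · exact ⟨Or.inl rfl, le_rfl, hi.ge⟩
        · exact ⟨Or.inr ⟨hx.1.1, hx.2⟩, h2 hx.1.1, hx.1.2.le⟩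
        · exact ⟨Or.inr ⟨hx.1, fun h => (h1 h).ne' hx.2⟩, h2 hx.1, hx.2.ge⟩
    rw [hook, h1, Finset.card_insert_of_notMem, Finset.card_union_of_disjoint,
      Finset.card_sdiff_of_subset fun x hx => mem_cups.2 ⟨hS.1 hx, hS.2.1 x hx⟩]
    · omega
    · refine Finset.disjoint_left.2 fun x hx hx' => ?_
      simp only [bars, Finset.mem_filter, Finset.mem_sdiff, mem_cups] at hx hx'
      exact hx.1.2.ne' hx'.2
    · simp [bars, mem_cups, hiV]
  rw [cutTerm, cutTerm, e1, e2, Finset.card_insert_of_notMem hiV, div_div,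
    show M + (V.card + 1 - S.card) = M + (V.card - S.card) + 1 by omega]
  congr 1
  ring

include hρ in
/-- The sum over all ways to cut arcs into fixed points, given by a power of the transfer
operator. -/
theorem sum_lowerSets_eq (V : Finset ι) (hV : ∀ i ∈ V, ρ i ∈ V) (M : ℕ)
    (ψ : ℕ → FractionRing ℤ[X]) :
    ∑ S ∈ lowerSets ρ V, cutTerm ρ V M ψ S
      = qFact M / qFact (M + (bars ρ V).card)
        * transfer^[(cups ρ V).card] ψ (M + (bars ρ V).card) / hookProd ρ V M := by
  induction hc : V.card using Nat.strong_induction_on generalizing V M ψ with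
  | _ c ih =>
  subst hc
  rcases V.eq_empty_or_nonempty with rfl | hne
  · have : lowerSets ρ (∅ : Finset ι) = {∅} := by
      ext S; simp [mem_lowerSets]; rintro rfl; simp
    simp [this, cutTerm, cutProd, hookProd, cups, bars, qFact_ne_zero]
  set i := V.min' hne with hi
  have hiV : i ∈ V := V.min'_mem hne
  have hmin : ∀ j ∈ V, i ≤ j := fun j hj => V.min'_le j hj
  -- The least point is either a fixed point, which is removed, or the start of an arc, at which `V`
  -- is split.
  rcases (hmin _ (hV i hiV)).eq_or_lt with hb | hlt
  · clear_value i
    set W := V.erase i with hW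
    have hV' : V = insert i W := (Finset.insert_erase hiV).symm
    have hiW : i ∉ W := Finset.notMem_erase i V
    have hlt : ∀ j ∈ W, i < j := fun j hj =>
      lt_of_le_of_ne (hmin j (Finset.mem_of_mem_erase hj)) (Finset.ne_of_mem_erase hj).symm
    have hcW : ∀ j ∈ W, ρ j ∈ W := by
      intro j hj
      refine Finset.mem_erase.2 ⟨fun h => ?_, hV j (Finset.mem_of_mem_erase hj)⟩
      have h2 : ρ (ρ j) = ρ i := by rw [h]
      rw [hρ.invol, ← hb] at h2
      exact hiW (h2 ▸ hj)
    clear_value W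
    subst hV'
    have e0 : cups ρ (insert i W) = cups ρ W := by
      rw [cups, Finset.filter_insert, if_neg (by rw [← hb]; exact lt_irrefl i), cups]
    have e1 : (bars ρ (insert i W)).card = (bars ρ W).card + 1 := by
      rw [bars, Finset.filter_insert, if_pos hb.symm,
        Finset.card_insert_of_notMem (by simp [hiW]), bars]
    have e2 : hookProd ρ (insert i W) M
        = qNum ((cups ρ W).card + (M + (bars ρ W).card) + 1) * hookProd ρ W M := by
      rw [hookProd_insert hlt hb.le, if_pos hb.symm]
      congr 2
      have h1 : (insert i W).filter (fun j => i ≤ j ∧ j ≤ ρ j ∧ (ρ i = i ∨ ρ j ≤ ρ i))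
          = insert i (cups ρ W ∪ bars ρ W) := by
        ext x
        have h2 : x ∈ W → i ≤ x := fun hx => (hlt x hx).le
        simp only [Finset.mem_filter, Finset.mem_insert, Finset.mem_union,
          mem_cups, bars, ← hb, true_or, and_true]
        constructor
        · rintro ⟨rfl | hx, -, h3⟩
          · exact Or.inl rfl
          · rcases h3.eq_or_lt with h4 | h4
            · exact Or.inr (Or.inr ⟨hx, h4.symm⟩)
            · exact Or.inr (Or.inl ⟨hx, h4⟩)
        · rintro (rfl | hx | hx)
          · exact ⟨Or.inl rfl, le_rfl, hb.le⟩
          · exact ⟨Or.inr hx.1, h2 hx.1, hx.2.le⟩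
          · exact ⟨Or.inr hx.1, h2 hx.1, hx.2.ge⟩
      rw [hook, h1, Finset.card_insert_of_notMem, Finset.card_union_of_disjoint]
      · ring
      · refine Finset.disjoint_left.2 fun x hx hx' => ?_
        simp only [bars, Finset.mem_filter, mem_cups] at hx hx'
        exact hx.2.ne' hx'.2
      · simp [bars, mem_cups, hiW]
    rw [lowerSets_insert_bar hb.symm hlt,
      Finset.sum_congr rfl fun S hS => cutTerm_insert_bar hρ hb.symm hlt hcW hS M ψ,
      ih _ (by rw [Finset.card_insert_of_notMem hiW]; omega) W hcW M _ rfl, e0, e1, e2,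
      ← add_assoc, ← transfer_iterate_bar, qFact_succ]
    have h1 := qFact_ne_zero (M + (bars ρ W).card)
    have h2 := qNum_succ_ne_zero (M + (bars ρ W).card)
    have h3 := qNum_succ_ne_zero ((cups ρ W).card + (M + (bars ρ W).card))
    have h4 := hookProd_ne_zero (ρ := ρ) W M
    generalize transfer^[_] _ _ = Y
    field_simp
  · obtain ⟨A, B, h⟩ := exists_cupSplit hρ hV hiV hmin hlt
    have hVc := h.card
    have hA0 : (bars ρ A).card = 0 := by
      rw [bars, Finset.filter_eq_empty_iff.2 fun {a} ha => h.left_ne a ha]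
      rfl
    have hA : ∀ M ψ, ∑ S ∈ lowerSets ρ A, cutTerm ρ A M ψ S
        = transfer^[(cups ρ A).card] ψ M / hookProd ρ A 0 := by
      intro M ψ
      rw [ih _ (by omega) A h.closed_left M ψ rfl, hA0, add_zero, div_self (qFact_ne_zero M),
        one_mul, hookProd_eq_of_forall_ne h.left_ne M 0]
    rw [h.sum_cutTerm hρ M ψ hA, ← Finset.sum_div, ih _ (by omega) B h.closed_right M _ rfl,
      ← Function.iterate_add_apply, h.cups_card hρ, h.bars_card hρ, h.hookProd_eq' hρ M 0,
      show (cups ρ B).card + ((cups ρ A).card + 1) = 1 + (cups ρ A).card + (cups ρ B).card by ring,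
      div_div]
    congr 1
    ring

end Involution

/-! ### Comparison of non-crossing involutions -/

section Involution

variable {ι : Type*} [LinearOrder ι] {ρ σ : ι → ι}

theorem card_filter_le [Fintype ι] (ρ : ι → ι) :
    (Finset.univ.filter fun i => i ≤ ρ i).card
      = (cups ρ Finset.univ).card + (bars ρ Finset.univ).card := by
  rw [cups, bars, ← Finset.card_union_of_disjoint, ← Finset.filter_or]
  · congr 1
    ext i
    simp only [Finset.mem_filter, le_iff_lt_or_eq, eq_comm]
  · refine Finset.disjoint_filter.2 fun i _ h h' => h.ne' h'

/-- The hypothesis `h`, here and below, means that `σ` arises from `ρ` by cutting arcs. The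
condition used in `cutProd` then singles out the far ends of the kept arcs. -/
theorem mem_cups_partner_iff [Fintype ι] (hρ : IsCupInvolution ρ) (hσ : IsCupInvolution σ)
    (h : ∀ i, σ i ≠ i → ρ i = σ i) (i : ι) : ρ i ∈ cups σ Finset.univ ↔ σ i < i := by
  rw [mem_cups]
  constructor
  · rintro ⟨-, h1⟩
    have h2 := h _ h1.ne'
    rw [hρ.invol] at h2
    rw [← h2] at h1
    have h3 : σ i = ρ i := by rw [h2, hσ.invol, ← h2]
    rwa [h3]
  · intro h1
    rw [h i h1.ne, hσ.invol]
    exact ⟨Finset.mem_univ _, h1⟩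

/-- No arc of `σ` encloses a fixed point of `σ`, so an arc of `ρ` below a kept arc cannot have been
cut. -/
theorem cups_mem_lowerSets [Fintype ι] (hσ : IsCupInvolution σ)
    (h : ∀ i, σ i ≠ i → ρ i = σ i) : cups σ Finset.univ ∈ lowerSets ρ Finset.univ := by
  simp only [mem_lowerSets, mem_cups, Finset.mem_univ, true_and, Finset.subset_univ]
  refine ⟨fun i hi => by rwa [h i hi.ne'], fun i hi j _ h1 h2 h3 => ?_⟩
  rw [h i hi.ne'] at h2
  rwa [← h j (hσ.nest i j h1 h2).2.2]

/-- Under a kept arc `σ` and `ρ` agree, so its hook may be computed in `ρ`; the hook of a fixed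
point of `σ` counts all lines of `σ` from there on. -/
theorem hookProd_eq_cutProd [Fintype ι] (hρ : IsCupInvolution ρ) (hσ : IsCupInvolution σ)
    (h : ∀ i, σ i ≠ i → ρ i = σ i) :
    hookProd σ Finset.univ 0 = cutProd ρ Finset.univ (cups σ Finset.univ) 0 := by
  have hS := mem_cups_partner_iff hρ hσ h
  unfold hookProd cutProd
  rw [Finset.filter_congr fun i _ => (?_ : ρ i ∉ cups σ Finset.univ ↔ i ≤ σ i)]
  · refine Finset.prod_congr rfl fun i hi => ?_
    have hi := (Finset.mem_filter.1 hi).2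
    rw [ite_self, add_zero, zero_add]
    congr 1
    split_ifs with hc
    · have hlt := (mem_cups.1 hc).2
      unfold hook
      congr 1
      refine Finset.filter_congr fun j _ => ?_
      rw [h i hlt.ne']
      have key : i ≤ j → j ≤ σ i → ρ j = σ j := by
        intro h1 h2
        rcases h1.eq_or_lt with rfl | h1
        · exact h i hlt.ne'
        rcases h2.eq_or_lt with rfl | h2
        · exact h _ (by rw [hσ.invol]; exact hlt.ne)
        · exact h j (hσ.nest i j h1 h2).2.2
      constructor
      · rintro ⟨h1, h2, h3⟩
        rw [key h1 (h2.trans (h3.resolve_left hlt.ne'))]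
        exact ⟨h1, h2, h3⟩
      · rintro ⟨h1, h2, h3⟩
        have hk := key h1 (h2.trans (h3.resolve_left hlt.ne'))
        rw [hk] at h2 h3
        exact ⟨h1, h2, h3⟩
    · have he : σ i = i := by
        by_contra hne
        exact hc (mem_cups.2 ⟨Finset.mem_univ _, lt_of_le_of_ne hi (Ne.symm hne)⟩)
      unfold hook
      congr 1
      refine Finset.filter_congr fun j _ => ?_
      rw [hS, not_lt, he]
      simp
  · rw [hS, not_lt]

theorem hookProd_map {κ : Type*} [LinearOrder κ] [Fintype κ] {τ : κ → κ} {d : κ → ι}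
    (hd : StrictMono d) (h : ∀ j, ρ (d j) = d (τ j)) :
    hookProd τ Finset.univ 0 = hookProd ρ (Finset.univ.map ⟨d, hd.injective⟩) 0 := by
  unfold hookProd
  rw [Finset.filter_map, Finset.prod_map]
  refine Finset.prod_congr ?_ fun j _ => ?_
  · ext j
    simp [h, hd.le_iff_le]
  · rw [ite_self, ite_self, add_zero, add_zero]
    unfold hook
    rw [Finset.filter_map, Finset.card_map]
    congr 2
    ext l
    simp [h, hd.le_iff_le, hd.injective.eq_iff]

/-- The right factor lives on the fixed points of `σ`. The complement of the cups of `σ` has in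
addition the far ends of kept arcs, which `hookProd` ignores. -/
theorem hookProd_eq_hookProd_sdiff [Fintype ι] (h : ∀ i, σ i ≠ i → ρ i = σ i) {κ : Type*} [LinearOrder κ] [Fintype κ] {τ : κ → κ} {d : κ → ι}
    (hd : StrictMono d) (hτ : ∀ j, ρ (d j) = d (τ j)) (hr : ∀ i, σ i = i ↔ ∃ j, d j = i) :
    hookProd τ Finset.univ 0 = hookProd ρ (Finset.univ \ cups σ Finset.univ) 0 := by
  rw [hookProd_map hd hτ]
  refine hookProd_congr (fun i hi => ?_) 0
  simp only [Finset.mem_map, Finset.mem_univ, true_and, Function.Embedding.coeFn_mk,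
    Finset.mem_sdiff, mem_cups, ← hr]
  constructor
  · intro h1; simp [h1]
  · intro h1
    by_contra h2
    rw [h i h2] at hi
    exact h1 (lt_of_le_of_ne hi (Ne.symm h2))

/-! ### Cutting arcs -/

/-- The involution which keeps only the arcs of `ρ` that start in `S`. -/
def cutMap (ρ : ι → ι) (S : Finset ι) (i : ι) : ι := if i ∈ S ∨ ρ i ∈ S then ρ i else i

theorem cutMap_ne {S : Finset ι} {i : ι} (h : cutMap ρ S i ≠ i) : ρ i = cutMap ρ S i := by
  unfold cutMap at h ⊢
  split_ifs at h ⊢ with h'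
  · rfl
  · exact absurd rfl h

/-- A kept arc encloses no new fixed point since `S` is a lower set; the enclosed point may be
either end of its arc. -/
theorem cutMap_isCupInvolution [Fintype ι] (hρ : IsCupInvolution ρ) {S : Finset ι}
    (hS : S ∈ lowerSets ρ Finset.univ) : IsCupInvolution (cutMap ρ S) := by
  rw [mem_lowerSets] at hS
  constructor
  · intro i
    by_cases h : i ∈ S ∨ ρ i ∈ S
    · have h' : ρ i ∈ S ∨ ρ (ρ i) ∈ S := by rw [hρ.invol]; exact h.symm
      rw [cutMap, cutMap, if_pos h, if_pos h', hρ.invol]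
    · rw [cutMap, cutMap, if_neg h, if_neg h]
  · intro i j h1 h2
    have h0 := cutMap_ne (h1.trans h2).ne'
    have hi : i ∈ S := by
      by_contra hi
      by_cases hi' : ρ i ∈ S
      · have := hS.2.1 _ hi'
        rw [hρ.invol, h0] at this
        exact (h1.trans h2).not_gt this
      · rw [cutMap, if_neg (by simp [hi, hi'])] at h2
        exact h1.not_gt h2
    rw [← h0] at h2 ⊢
    have h3 := hρ.nest i j h1 h2
    have hj : j ∈ S ∨ ρ j ∈ S := by
      rcases lt_or_gt_of_ne h3.2.2 with h4 | h4
      · refine Or.inr (hS.2.2 i hi _ (Finset.mem_univ _) h3.1 h3.2.1 ?_)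
        rwa [hρ.invol]
      · exact Or.inl (hS.2.2 i hi _ (Finset.mem_univ _) h1 h2 h4)
    rwa [cutMap, if_pos hj]

theorem cups_cutMap [Fintype ι] (hρ : IsCupInvolution ρ) {S : Finset ι}
    (hS : S ∈ lowerSets ρ Finset.univ) : cups (cutMap ρ S) Finset.univ = S := by
  rw [mem_lowerSets] at hS
  ext i
  rw [mem_cups, cutMap]
  constructor
  · rintro ⟨-, h⟩
    split_ifs at h with h'
    · refine h'.resolve_right fun h2 => ?_
      have := hS.2.1 _ h2
      rw [hρ.invol] at this
      exact this.not_gt h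
    · exact absurd h (lt_irrefl i)
  · intro h
    rw [if_pos (Or.inl h)]
    exact ⟨Finset.mem_univ _, hS.2.1 i h⟩

/-- This makes the left factor of a factorization unique, given its cups. -/
theorem eq_cutMap [Fintype ι] (hρ : IsCupInvolution ρ) (hσ : IsCupInvolution σ)
    (h : ∀ i, σ i ≠ i → ρ i = σ i) : σ = cutMap ρ (cups σ Finset.univ) := by
  funext i
  have hS := mem_cups_partner_iff hρ hσ h i
  unfold cutMap
  by_cases hi : σ i = i
  · rw [if_neg]
    · exact hi
    · rw [hS, mem_cups, hi]
      simp
  · rw [if_pos, h i hi]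
    rw [hS, mem_cups]
    rcases lt_or_gt_of_ne hi with h2 | h2
    · exact Or.inr h2
    · exact Or.inl ⟨Finset.mem_univ _, h2⟩

end Involution

/-! ### Monic diagrams -/

namespace Diagram

variable {n m k : ℕ}

/-- The involution of the source sites given by the lines that join two source sites. -/
def cupMap (x : Diagram n m) (i : Fin n) : Fin n := Sum.elim id (fun _ => i) (x.partner (Sum.inl i))

theorem cupMap_of_inl {x : Diagram n m} {i j : Fin n} (h : x.partner (Sum.inl i) = Sum.inl j) :
    x.cupMap i = j := by simp [cupMap, h]

theorem cupMap_of_inr {x : Diagram n m} {i : Fin n} {j : Fin m}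
    (h : x.partner (Sum.inl i) = Sum.inr j) : x.cupMap i = i := by simp [cupMap, h]

theorem partner_inl_of_ne {x : Diagram n m} {i : Fin n} (h : x.cupMap i ≠ i) :
    x.partner (Sum.inl i) = Sum.inl (x.cupMap i) := by
  rcases h' : x.partner (Sum.inl i) with j | j
  · rw [cupMap_of_inl h']
  · exact absurd (cupMap_of_inr h') h

theorem partner_inl_of_eq {x : Diagram n m} {i : Fin n} (h : x.cupMap i = i) :
    ∃ j, x.partner (Sum.inl i) = Sum.inr j := by
  rcases h' : x.partner (Sum.inl i) with j | j
  · rw [cupMap_of_inl h'] at h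
    subst h
    exact absurd h' (x.partner_ne _)
  · exact ⟨j, rfl⟩

theorem cupMap_isCupInvolution (x : Diagram n m) : IsCupInvolution x.cupMap := by
  have hinv : ∀ i, x.cupMap (x.cupMap i) = i := by
    intro i
    by_cases h : x.cupMap i = i
    · rw [h, h]
    · apply cupMap_of_inl
      rw [← partner_inl_of_ne h, x.partner_partner]
  refine ⟨hinv, fun i j h1 h2 => ?_⟩
  have hi := partner_inl_of_ne (h1.trans h2).ne'
  have hp := x.planar (Sum.inl i) (Sum.inl j)
  rw [hi] at hp
  have hj : x.cupMap j ≠ j := by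
    intro h
    obtain ⟨l, hl⟩ := partner_inl_of_eq h
    rw [hl] at hp
    simp only [pos] at hp
    omega
  have hp2 := x.planar (Sum.inl (x.cupMap j)) (Sum.inl i)
  rw [← partner_inl_of_ne hj, x.partner_partner, hi, partner_inl_of_ne hj] at hp2
  rw [partner_inl_of_ne hj] at hp
  have h3 : x.cupMap j ≠ i := by
    intro h
    have := hinv j
    rw [h] at this
    exact h2.ne this.symm
  have h4 : x.cupMap j ≠ x.cupMap i := by
    intro h
    have := hinv j
    rw [h, hinv] at this
    exact h1.ne this
  simp only [pos] at hp hp2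
  refine ⟨?_, ?_, hj⟩ <;> omega

/-- The target sites of `x` are joined to the source sites given by `d`. -/
def Threaded (x : Diagram n m) (d : Fin m → Fin n) : Prop :=
  ∀ j, x.partner (Sum.inr j) = Sum.inl (d j)

/-- The `m` source sites on through lines map injectively to the `m` target sites, hence onto them.
-/
theorem IsMonic.exists_threaded {x : Diagram n m} (hx : x.IsMonic) : ∃ d, x.Threaded d := by
  suffices h : ∀ j, ∃ i, x.partner (Sum.inr j) = Sum.inl i from ⟨_, fun j => (h j).choose_spec⟩
  let f (i : {i : Fin n // ∃ j : Fin m, x.partner (Sum.inl i) = Sum.inr j}) : Fin m :=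
    i.2.choose
  have hf : ∀ i, x.partner (Sum.inl i.1) = Sum.inr (f i) := fun i => i.2.choose_spec
  have hinj : Function.Injective f := by
    intro i i' h
    have h1 := hf i
    rw [h, ← hf i'] at h1
    have h2 := congrArg x.partner h1
    rw [x.partner_partner, x.partner_partner] at h2
    exact Subtype.ext (Sum.inl_injective h2)
  have hbij : Function.Bijective f := by
    rw [Nat.bijective_iff_injective_and_card]
    refine ⟨hinj, ?_⟩
    rw [Nat.card_fin]
    exact hx.2
  intro j
  obtain ⟨i, rfl⟩ := hbij.2 j
  exact ⟨i.1, by rw [← hf i, x.partner_partner]⟩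

namespace Threaded

variable {x : Diagram n m} {d : Fin m → Fin n} (h : x.Threaded d)

include h

theorem partner_inl (j : Fin m) : x.partner (Sum.inl (d j)) = Sum.inr j := by
  rw [← h j, x.partner_partner]

theorem strictMono : StrictMono d := by
  intro i j hij
  have h1 := x.planar (Sum.inl (d j)) (Sum.inl (d i))
  rw [h.partner_inl, h.partner_inl] at h1
  have h2 : d i ≠ d j := by
    intro h3
    have h4 := h.partner_inl i
    rw [h3, h.partner_inl] at h4
    exact hij.ne (Sum.inr_injective h4).symm
  simp only [pos] at h1
  omega

theorem cupMap_eq_iff (i : Fin n) : x.cupMap i = i ↔ ∃ j, d j = i := by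
  constructor
  · intro hi
    obtain ⟨j, hj⟩ := partner_inl_of_eq hi
    refine ⟨j, ?_⟩
    have := h j
    rw [← hj, x.partner_partner] at this
    exact (Sum.inl_injective this).symm
  · rintro ⟨j, rfl⟩
    exact cupMap_of_inr (h.partner_inl j)

theorem card_bars : (bars x.cupMap Finset.univ).card = m := by
  have : bars x.cupMap Finset.univ = Finset.univ.map ⟨d, h.strictMono.injective⟩ := by
    ext i
    simp [bars, h.cupMap_eq_iff]
  rw [this, Finset.card_map, Finset.card_univ, Fintype.card_fin]

theorem card_cups : n = 2 * (cups x.cupMap Finset.univ).card + m := by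
  have := card_eq_cups_add_bars x.cupMap_isCupInvolution (V := Finset.univ) (by simp)
  rwa [h.card_bars, Finset.card_univ, Fintype.card_fin] at this

theorem isMonic : x.IsMonic := by
  refine ⟨by have := h.card_cups; omega, ?_⟩
  have e : Fin m ≃ {i : Fin n // ∃ j : Fin m, x.partner (Sum.inl i) = Sum.inr j} := by
    refine Equiv.ofBijective (fun j => ⟨d j, j, h.partner_inl j⟩) ⟨fun i j hij => ?_, ?_⟩
    · exact h.strictMono.injective (congrArg Subtype.val hij)
    · rintro ⟨i, j, hj⟩
      obtain ⟨l, hl⟩ := (h.cupMap_eq_iff i).1 (cupMap_of_inr hj)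
      exact ⟨l, Subtype.ext hl⟩
  rw [propagationNumber, ← Nat.card_congr e, Nat.card_fin]

theorem ext_cupMap {x' : Diagram n m} {d' : Fin m → Fin n} (h' : x'.Threaded d')
    (hc : x.cupMap = x'.cupMap) : x = x' ∧ d = d' := by
  have hd : d = d' := by
    rw [← h.strictMono.range_inj h'.strictMono]
    ext i
    rw [Set.mem_range, Set.mem_range, ← h.cupMap_eq_iff, ← h'.cupMap_eq_iff, hc]
  subst hd
  refine ⟨Diagram.ext (funext fun p => ?_), rfl⟩
  rcases p with i | j
  · by_cases hi : x.cupMap i = i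
    · obtain ⟨j, rfl⟩ := (h.cupMap_eq_iff i).1 hi
      rw [h.partner_inl, h'.partner_inl]
    · rw [partner_inl_of_ne hi, partner_inl_of_ne (hc ▸ hi), hc]
  · rw [h j, h' j]

/-- The edges of a monic diagram correspond to their first end points. -/
noncomputable def edgeEquiv : {i : Fin n // i ≤ x.cupMap i} ≃ x.Edge := by
  refine Equiv.ofBijective (fun i => ⟨Sum.inl i.1, ?_⟩) ⟨?_, ?_⟩
  · by_cases hi : x.cupMap i.1 = i.1
    · obtain ⟨j, hj⟩ := partner_inl_of_eq hi
      rw [hj]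
      simp only [pos]
      omega
    · rw [partner_inl_of_ne hi]
      exact lt_of_le_of_ne (Fin.le_def.1 i.2) fun h' => hi (Fin.ext h'.symm)
  · intro i j hij
    exact Subtype.ext (Sum.inl_injective (congrArg Subtype.val hij))
  · rintro ⟨i | j, hp⟩
    · refine ⟨⟨i, ?_⟩, rfl⟩
      by_cases hi : x.cupMap i = i
      · exact hi.ge
      · rw [partner_inl_of_ne hi] at hp
        exact hp.le
    · rw [h j] at hp
      simp only [pos] at hp
      omega

/-- After rotation a through line encloses everything that starts below it, and a cup encloses no
through line. So through lines play the role of the fixed points in `hook`. -/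
theorem edgeEquiv_le (i j : {i : Fin n // i ≤ x.cupMap i}) :
    h.edgeEquiv j ≤ h.edgeEquiv i ↔
      i.1 ≤ j.1 ∧ (x.cupMap i.1 = i.1 ∨ x.cupMap j.1 ≤ x.cupMap i.1) := by
  obtain ⟨i, hi⟩ := i
  obtain ⟨j, hj⟩ := j
  change pos (Sum.inl i) ≤ pos (Sum.inl j) ∧
    pos (x.partner (Sum.inl j)) ≤ pos (x.partner (Sum.inl i)) ↔ _
  refine and_congr_right fun hij => ?_
  have hij : i ≤ j := hij
  dsimp only
  by_cases h1 : x.cupMap i = i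
  · simp only [h1, true_or, iff_true]
    obtain ⟨s, rfl⟩ := (h.cupMap_eq_iff i).1 h1
    rw [h.partner_inl]
    by_cases h2 : x.cupMap j = j
    · obtain ⟨t, rfl⟩ := (h.cupMap_eq_iff j).1 h2
      rw [h.partner_inl]
      have := h.strictMono.le_iff_le.1 hij
      simp only [pos]
      omega
    · rw [partner_inl_of_ne h2]
      simp only [pos]
      omega
  · simp only [h1, false_or]
    rw [partner_inl_of_ne h1]
    by_cases h2 : x.cupMap j = j
    · obtain ⟨t, rfl⟩ := (h.cupMap_eq_iff j).1 h2
      rw [h.partner_inl, h2]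
      have h3 : ¬ (d t ≤ x.cupMap i) := by
        intro h3
        have h4 : i ≠ d t := fun h4 => h1 (h4 ▸ h2)
        have h5 : d t ≠ x.cupMap i := by
          intro h5
          have h6 := x.cupMap_isCupInvolution.invol i
          rw [← h5, h2] at h6
          exact h4 h6.symm
        exact (x.cupMap_isCupInvolution.nest i (d t) (lt_of_le_of_ne hij h4)
          (lt_of_le_of_ne h3 h5)).2.2 h2
      simp only [h3, iff_false]
      simp only [pos]
      omega
    · rw [partner_inl_of_ne h2]
      simp only [pos]
      exact Iff.rfl

theorem forestPolynomial_edge :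
    algebraMap ℤ[X] (FractionRing ℤ[X]) (forestPolynomial x.Edge)
      = qFact ((cups x.cupMap Finset.univ).card + m) / hookProd x.cupMap Finset.univ 0 := by
  have hc : Fintype.card x.Edge = (cups x.cupMap Finset.univ).card + m := by
    rw [← Fintype.card_congr h.edgeEquiv, Fintype.card_subtype,
      card_filter_le, h.card_bars]
  have hp : algebraMap ℤ[X] (FractionRing ℤ[X])
      (∏ e : x.Edge, quantumNumber (Nat.card {f : x.Edge // f ≤ e}))
        = hookProd x.cupMap Finset.univ 0 := by
    have hterm : ∀ i, qNum (hook x.cupMap Finset.univ i.1) = algebraMap ℤ[X] (FractionRing ℤ[X])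
        (quantumNumber (Nat.card {f : x.Edge // f ≤ h.edgeEquiv i})) := by
      intro i
      unfold qNum
      congr 3
      have e : {j : {i : Fin n // i ≤ x.cupMap i} // h.edgeEquiv j ≤ h.edgeEquiv i} ≃
          {f : x.Edge // f ≤ h.edgeEquiv i} :=
        h.edgeEquiv.subtypeEquiv fun j => Iff.rfl
      rw [← Nat.card_congr e, hook, ← Fintype.card_subtype, ← Nat.card_eq_fintype_card]
      refine Nat.card_congr ⟨fun j => ⟨⟨j.1, j.2.2.1⟩, ?_⟩, fun j => ⟨j.1.1, ?_⟩,
        fun j => rfl, fun j => rfl⟩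
      · rw [edgeEquiv_le]
        exact ⟨j.2.1, j.2.2.2⟩
      · have := (h.edgeEquiv_le i j.1).1 j.2
        exact ⟨this.1, j.1.2, this.2⟩
    rw [map_prod]
    refine (Fintype.prod_equiv h.edgeEquiv _ _ hterm).symm.trans ?_
    simp only [hookProd, ite_self, add_zero]
    exact (Finset.prod_subtype _ (by simp) fun i => qNum (hook x.cupMap Finset.univ i)).symm
  rw [eq_div_iff (hookProd_ne_zero _ _), ← hp, ← map_mul, forestPolynomial_edge_mul, hc, qFact]

end Threaded

/-! ### Composition of monic diagrams -/

/-- Every middle site hangs on a source site `d j`, so gluing merely transports the lines of `y`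
along `d` and adds the cups of `x`. -/
theorem Threaded.isComposite_iff {x : Diagram n m} {y : Diagram m k} {z : Diagram n k}
    {d : Fin m → Fin n} (hx : x.Threaded d) : x.IsComposite y z ↔
      (∀ i, x.cupMap i ≠ i → z.partner (Sum.inl i) = Sum.inl (x.cupMap i)) ∧
      ∀ p, z.partner (Sum.map d id p) = Sum.map d id (y.partner p) := by
  have hxadj : ∀ p q, x.partner p = q → (x.glue y).Adj
      (((Function.Embedding.refl (Fin n)).sumMap Function.Embedding.inl) p)
      (((Function.Embedding.refl (Fin n)).sumMap Function.Embedding.inl) q) := by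
    intro p q hpq
    exact Or.inl ((SimpleGraph.map_adj _ _ _ _).2 ⟨p, q, hpq, rfl, rfl⟩)
  have hyadj : ∀ p q, y.partner p = q → (x.glue y).Adj (Sum.inr p) (Sum.inr q) := by
    intro p q hpq
    exact Or.inr ((SimpleGraph.map_adj _ _ _ _).2 ⟨p, q, hpq, rfl, rfl⟩)
  have hmid : ∀ p, (x.glue y).Reachable (Sum.map id Sum.inr (Sum.map d id p)) (Sum.inr p) := by
    rintro (j | l)
    · exact (hxadj _ _ (hx.partner_inl j)).reachable
    · exact SimpleGraph.Reachable.refl _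
  have hreach : ∀ p, (x.glue y).Reachable (Sum.map id Sum.inr (Sum.map d id p))
      (Sum.map id Sum.inr (Sum.map d id (y.partner p))) := fun p =>
    ((hmid p).trans (hyadj p _ rfl).reachable).trans (hmid _).symm
  have hcup : ∀ i, x.cupMap i ≠ i → (x.glue y).Reachable (Sum.inl i) (Sum.inl (x.cupMap i)) :=
    fun i hi => (hxadj _ _ (partner_inl_of_ne hi)).reachable
  have hinj : Function.Injective (Sum.map d id : Fin m ⊕ Fin k → Fin n ⊕ Fin k) :=
    Sum.map_injective.2 ⟨hx.strictMono.injective, Function.injective_id⟩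
  constructor
  · intro h
    refine ⟨fun i hi => (h _ _).2 ⟨?_, hcup i hi⟩, fun p => (h _ _).2 ⟨?_, hreach p⟩⟩
    · exact fun h' => hi (Sum.inl_injective h').symm
    · exact fun h' => y.partner_ne p (hinj h').symm
  · rintro ⟨h1, h2⟩ p q
    -- Each vertex is sent to the line of `z` through it, given by its end points. This is constant
    -- along edges, so connected outer sites lie on one line of `z`.
    let f : Fin n ⊕ (Fin m ⊕ Fin k) → Sym2 (Fin n ⊕ Fin k) := Sum.elim
      (fun i => s(Sum.inl i, z.partner (Sum.inl i)))
      (fun p => s(Sum.map d id p, z.partner (Sum.map d id p)))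
    have hf : ∀ u v, (x.glue y).Adj u v → f u = f v := by
      rintro u v (huv | huv)
      · obtain ⟨p, q, hpq, rfl, rfl⟩ := (SimpleGraph.map_adj _ _ _ _).1 huv
        have hpq : x.partner p = q := hpq
        subst hpq
        rcases p with i | j
        · by_cases hi : x.cupMap i = i
          · obtain ⟨j, rfl⟩ := (hx.cupMap_eq_iff i).1 hi
            rw [hx.partner_inl]
            rfl
          · rw [partner_inl_of_ne hi]
            change s(Sum.inl i, z.partner (Sum.inl i))
              = s(Sum.inl (x.cupMap i), z.partner (Sum.inl (x.cupMap i)))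
            rw [← h1 i hi, z.partner_partner, Sym2.eq_swap]
        · rw [hx j]
          rfl
      · obtain ⟨p, q, hpq, rfl, rfl⟩ := (SimpleGraph.map_adj _ _ _ _).1 huv
        have hpq : y.partner p = q := hpq
        subst hpq
        change s(Sum.map d id p, z.partner (Sum.map d id p))
          = s(Sum.map d id (y.partner p), z.partner (Sum.map d id (y.partner p)))
        rw [← h2, z.partner_partner, Sym2.eq_swap]
    have hf' : ∀ u v, (x.glue y).Reachable u v → f u = f v := by
      rintro u v ⟨w⟩
      induction w with
      | nil => rfl
      | cons hadj _ ih => exact (hf _ _ hadj).trans ih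
    have hfo : ∀ p : Fin n ⊕ Fin k, f (Sum.map id Sum.inr p) = s(p, z.partner p) := by
      rintro (i | l) <;> rfl
    constructor
    · rintro rfl
      refine ⟨(z.partner_ne p).symm, ?_⟩
      rcases p with i | l
      · by_cases hi : x.cupMap i = i
        · obtain ⟨j, rfl⟩ := (hx.cupMap_eq_iff i).1 hi
          have := hreach (Sum.inl j)
          rw [← h2] at this
          exact this
        · rw [h1 i hi]
          exact hcup i hi
      · have := hreach (Sum.inr l)
        rw [← h2] at this
        exact this
    · rintro ⟨hne, hr⟩
      have := hf' _ _ hr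
      rw [hfo, hfo, Sym2.eq_iff] at this
      rcases this with h' | h'
      · exact absurd h'.1 hne
      · exact h'.2

theorem Threaded.loops_eq_zero {x : Diagram n m} {d : Fin m → Fin n} (hx : x.Threaded d)
    (y : Diagram m k) : x.loops y = 0 := by
  rw [loops, Nat.card_eq_zero]
  refine Or.inl ⟨?_⟩
  rintro ⟨C, hC⟩
  obtain ⟨v, hv⟩ := C.nonempty_supp
  obtain ⟨j, rfl⟩ := hC hv
  have hadj : (x.glue y).Adj (Sum.inr (Sum.inl j)) (Sum.inl (d j)) :=
    Or.inl ((SimpleGraph.map_adj _ _ _ _).2 ⟨Sum.inr j, Sum.inl (d j), hx j, rfl, rfl⟩)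
  have hmem : Sum.inl (d j) ∈ C.supp := by
    rw [SimpleGraph.ConnectedComponent.mem_supp_iff] at hv ⊢
    rw [← hv]
    exact (SimpleGraph.ConnectedComponent.connectedComponentMk_eq_of_adj hadj).symm
  obtain ⟨l, hl⟩ := hC hmem
  exact Sum.inr_ne_inl hl

theorem Threaded.of_isComposite {x : Diagram n m} {y : Diagram m k} {z : Diagram n k}
    {d : Fin m → Fin n} {d' : Fin k → Fin m} (hx : x.Threaded d) (hy : y.Threaded d')
    (h : x.IsComposite y z) : z.Threaded (d ∘ d') := by
  intro l
  have := (hx.isComposite_iff.1 h).2 (Sum.inr l)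
  rw [hy l] at this
  exact this

/-- Through lines attached to the fixed points in order do not cross each other, and they cross no
cup because no cup encloses a fixed point. -/
theorem exists_threaded_of_isCupInvolution {σ : Fin n → Fin n} (hσ : IsCupInvolution σ)
    {d : Fin m → Fin n} (hd : StrictMono d) (hr : ∀ i, σ i = i ↔ ∃ j, d j = i) :
    ∃ x : Diagram n m, x.Threaded d ∧ x.cupMap = σ := by
  classical
  let P : Fin n ⊕ Fin m → Fin n ⊕ Fin m := Sum.elim
    (fun i => if h : ∃ j, d j = i then Sum.inr h.choose else Sum.inl (σ i)) (fun j => Sum.inl (d j))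
  have hP1 : ∀ j, P (Sum.inl (d j)) = Sum.inr j := by
    intro j
    have h : ∃ l, d l = d j := ⟨j, rfl⟩
    change dite _ _ _ = _
    rw [dif_pos h, hd.injective h.choose_spec]
  have hP2 : ∀ i, σ i ≠ i → P (Sum.inl i) = Sum.inl (σ i) := by
    intro i hi
    exact dif_neg fun h => hi ((hr i).2 h)
  have hP3 : ∀ j, P (Sum.inr j) = Sum.inl (d j) := fun j => rfl
  have hσne : ∀ i, σ i ≠ i → σ (σ i) ≠ σ i := by
    intro i hi h
    rw [hσ.invol] at h
    exact hi h.symm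
  clear_value P
  refine ⟨⟨P, ?_, ?_, ?_⟩, hP3, ?_⟩
  · rintro (i | j)
    · by_cases hi : σ i = i
      · obtain ⟨j, rfl⟩ := (hr i).1 hi
        rw [hP1, hP3]
      · rw [hP2 i hi, hP2 _ (hσne i hi), hσ.invol]
    · rw [hP3, hP1]
  · rintro (i | j)
    · by_cases hi : σ i = i
      · obtain ⟨j, rfl⟩ := (hr i).1 hi
        rw [hP1]
        exact Sum.inr_ne_inl
      · rw [hP2 i hi]
        exact fun h => hi (Sum.inl_injective h)
    · rw [hP3]
      exact Sum.inl_ne_inr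
  · rintro (i | s) (j | t) ⟨h1, h2, h3⟩
    · by_cases hi : σ i = i
      · obtain ⟨s, rfl⟩ := (hr i).1 hi
        rw [hP1] at h2 h3
        by_cases hj : σ j = j
        · obtain ⟨t, rfl⟩ := (hr j).1 hj
          rw [hP1] at h3
          have h4 : d s < d t := h1
          have := hd.lt_iff_lt.1 h4
          simp only [pos] at h3
          omega
        · rw [hP2 j hj] at h3
          simp only [pos] at h3
          omega
      · rw [hP2 i hi] at h2 h3
        have h4 := hσ.nest i j h1 h2
        rw [hP2 j h4.2.2] at h3
        exact h4.2.1.not_gt h3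
    · rw [hP3] at h3
      simp only [pos] at h2 h3
      omega
    · rw [hP3] at h2
      simp only [pos] at h1 h2
      omega
    · rw [hP3] at h2
      simp only [pos] at h1 h2
      omega
  · funext i
    by_cases hi : σ i = i
    · obtain ⟨j, rfl⟩ := (hr i).1 hi
      rw [hi]
      exact cupMap_of_inr (hP1 j)
    · exact cupMap_of_inl (hP2 i hi)

/-- A set of sites closed under `z.partner` inherits planarity, as `e` preserves the order along the
border. -/
theorem exists_pullback {n' m' : ℕ} (z : Diagram n m) {e : Fin n' ⊕ Fin m' → Fin n ⊕ Fin m}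
    (he : Function.Injective e) (hpos : ∀ p q, pos p < pos q → pos (e p) < pos (e q))
    (hc : ∀ p, ∃ q, z.partner (e p) = e q) :
    ∃ y : Diagram n' m', ∀ p, z.partner (e p) = e (y.partner p) := by
  choose P hP using hc
  refine ⟨⟨P, fun p => he ?_, fun p h => ?_, fun p q h => ?_⟩, hP⟩
  · rw [← hP, ← hP, z.partner_partner]
  · refine z.partner_ne (e p) ?_
    rw [hP, h]
  · refine z.planar (e p) (e q) ?_
    rw [hP, hP]
    exact ⟨hpos _ _ h.1, hpos _ _ h.2.1, hpos _ _ h.2.2⟩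

/-- Every lower set of cups of a monic diagram is the set of cups of the left factor in a
factorization into monic diagrams. -/
theorem Threaded.exists_factorization {z : Diagram n k} {dz : Fin k → Fin n} (hz : z.Threaded dz)
    {S : Finset (Fin n)} (hS : S ∈ lowerSets z.cupMap Finset.univ) (hc : n = 2 * S.card + m) :
    ∃ (x : Diagram n m) (y : Diagram m k) (d : Fin m → Fin n) (d' : Fin k → Fin m),
      x.Threaded d ∧ y.Threaded d' ∧ x.IsComposite y z ∧ cups x.cupMap Finset.univ = S := by
  have hρ := z.cupMap_isCupInvolution
  set ρ := z.cupMap with hρz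
  have hσ := cutMap_isCupInvolution hρ hS
  have hcups := cups_cutMap hρ hS
  have hbars : (bars (cutMap ρ S) Finset.univ).card = m := by
    have := card_eq_cups_add_bars hσ (V := Finset.univ) (by simp)
    rw [hcups, Finset.card_univ, Fintype.card_fin] at this
    omega
  set d := (bars (cutMap ρ S) Finset.univ).orderEmbOfFin hbars with hd
  have hr : ∀ i, cutMap ρ S i = i ↔ ∃ j, d j = i := by
    intro i
    have := Finset.range_orderEmbOfFin (bars (cutMap ρ S) Finset.univ) hbars
    have h2 : i ∈ Set.range d ↔ i ∈ bars (cutMap ρ S) Finset.univ := by rw [this]; rfl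
    rw [← Set.mem_range, h2]
    simp [bars]
  obtain ⟨x, hx, hxc⟩ := exists_threaded_of_isCupInvolution hσ d.strictMono hr
  have hS' := mem_lowerSets.1 hS
  have hfix : ∀ i, i ∉ S → ρ i ∉ S → ∃ j, d j = i := fun i h1 h2 =>
    (hr i).1 (by rw [cutMap, if_neg (by simp [h1, h2])])
  have hfix' : ∀ j, d j ∉ S ∧ ρ (d j) ∉ S := by
    intro j
    have h1 := (hr (d j)).2 ⟨j, rfl⟩
    rw [cutMap] at h1
    split_ifs at h1 with h2
    · rcases h2 with h2 | h2
      · exact absurd h1 (hS'.2.1 _ h2).ne'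
      · have := hS'.2.1 _ h2
        rw [h1, h1] at this
        exact absurd this (lt_irrefl _)
    · exact not_or.1 h2
  -- The sites off the kept arcs, together with the targets, are closed under `z.partner`; the right
  -- factor is the restriction of `z` to them.
  have hclosed : ∀ p : Fin m ⊕ Fin k, ∃ q, z.partner (Sum.map d id p) = Sum.map d id q := by
    rintro (j | l)
    · change ∃ q, z.partner (Sum.inl (d j)) = _
      by_cases hj : ρ (d j) = d j
      · obtain ⟨l, hl⟩ := partner_inl_of_eq hj
        exact ⟨Sum.inr l, hl⟩
      · obtain ⟨t, ht⟩ := hfix (ρ (d j)) (hfix' j).2 (by rw [hρ.invol]; exact (hfix' j).1)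
        refine ⟨Sum.inl t, ?_⟩
        rw [partner_inl_of_ne hj, ← hρz, ← ht]
        rfl
    · have h1 : ρ (dz l) = dz l := (hz.cupMap_eq_iff _).2 ⟨l, rfl⟩
      have h2 : dz l ∉ S := fun h => (hS'.2.1 _ h).ne' h1
      obtain ⟨t, ht⟩ := hfix (dz l) h2 (by rwa [h1])
      refine ⟨Sum.inl t, ?_⟩
      change z.partner (Sum.inr l) = Sum.inl (d t)
      rw [hz l, ht]
  have hinj : Function.Injective (Sum.map d id : Fin m ⊕ Fin k → Fin n ⊕ Fin k) :=
    Sum.map_injective.2 ⟨d.injective, Function.injective_id⟩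
  have hpos : ∀ p q : Fin m ⊕ Fin k, pos p < pos q →
      pos (Sum.map d id p : Fin n ⊕ Fin k) < pos (Sum.map d id q : Fin n ⊕ Fin k) := by
    rintro (i | s) (j | t) hpq
    · exact d.strictMono hpq
    · simp only [Sum.map_inl, Sum.map_inr, pos]
      omega
    · simp only [pos] at hpq
      omega
    · simp only [Sum.map_inr, pos, id] at hpq ⊢
      omega
  obtain ⟨y, hy⟩ := exists_pullback z hinj hpos hclosed
  have hyt : ∀ l, ∃ j, y.partner (Sum.inr l) = Sum.inl j := by
    intro l
    have h1 := hy (Sum.inr l)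
    change z.partner (Sum.inr l) = _ at h1
    rw [hz l] at h1
    rcases hq : y.partner (Sum.inr l) with j | j
    · exact ⟨j, rfl⟩
    · rw [hq] at h1
      exact absurd h1 Sum.inl_ne_inr
  choose d' hd' using hyt
  refine ⟨x, y, d, d', hx, hd', hx.isComposite_iff.2 ⟨fun i hi => ?_, hy⟩, by rw [hxc, hcups]⟩
  rw [hxc] at hi ⊢
  have h1 := cutMap_ne hi
  rw [← h1] at hi ⊢
  exact partner_inl_of_ne hi

end Diagram

/-! ### Coefficients of the composite -/

/-- The sum over the lower sets with a given number of arcs. -/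
theorem sum_lowerSets_card_eq {ι : Type*} [LinearOrder ι] [Fintype ι] {ρ : ι → ι}
    (hρ : IsCupInvolution ρ) {s t c : ℕ} (hs : (cups ρ Finset.univ).card = s + t)
    (hc : (bars ρ Finset.univ).card = c) :
    ∑ S ∈ lowerSets ρ Finset.univ with S.card = s,
        qFact (s + (2 * t + c)) / cutProd ρ Finset.univ S 0
          * (qFact (t + c) / hookProd ρ (Finset.univ \ S) 0)
      = qFact (s + t) / (qFact s * qFact t)
        * (qFact (s + t + c) / hookProd ρ Finset.univ 0) := by
  have hcard := card_eq_cups_add_bars hρ (V := Finset.univ) (by simp)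
  rw [hs, hc] at hcard
  -- There are `2(s+t) + c` points, so the indicator selects `|S| = s` on the left and the single
  -- term `(s, t)` of the transfer power on the right.
  have key := sum_lowerSets_eq hρ Finset.univ (by simp) 0
    (fun l => if l = s + 2 * t + c then 1 else 0)
  rw [transfer_iterate, hs, hc, Finset.sum_eq_single (s, t)] at key
  · have h1 : ∀ S ∈ lowerSets ρ Finset.univ,
        cutTerm ρ Finset.univ 0 (fun l => if l = s + 2 * t + c then 1 else 0) S
          = if S.card = s then
            1 / (cutProd ρ Finset.univ S 0 * hookProd ρ (Finset.univ \ S) 0) else 0 := by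
      intro S hS
      have h2 : S.card ≤ (cups ρ Finset.univ).card := Finset.card_le_card fun x hx =>
        mem_cups.2 ⟨Finset.mem_univ _, (mem_lowerSets.1 hS).2.1 x hx⟩
      have h3 : 0 + ((Finset.univ : Finset ι).card - S.card) = s + 2 * t + c ↔ S.card = s := by
        omega
      rw [cutTerm]
      simp only [h3]
      split_ifs <;> simp
    rw [Finset.sum_congr rfl h1, ← Finset.sum_filter] at key
    have h4 : ∀ S : Finset ι, qFact (s + (2 * t + c)) / cutProd ρ Finset.univ S 0
          * (qFact (t + c) / hookProd ρ (Finset.univ \ S) 0)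
        = qFact (s + 2 * t + c) * qFact (t + c)
          * (1 / (cutProd ρ Finset.univ S 0 * hookProd ρ (Finset.univ \ S) 0)) := by
      intro S
      rw [div_mul_div_comm, mul_one_div, ← add_assoc]
    rw [Finset.sum_congr rfl fun S _ => h4 S, ← Finset.mul_sum, key, if_pos (by ring),
      transferCoeff, qFact_zero, show 0 + c + s + t = s + t + c by ring,
      show 0 + c + s + 2 * t = s + 2 * t + c by ring, show 0 + c + t = t + c by ring, zero_add]
    have := qFact_ne_zero c
    have := qFact_ne_zero s
    have := qFact_ne_zero t
    have := qFact_ne_zero (t + c)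
    have := qFact_ne_zero (s + 2 * t + c)
    have := hookProd_ne_zero (ρ := ρ) Finset.univ 0
    field_simp
  · rintro ⟨k, j⟩ hp hne
    rw [mem_antidiagonal] at hp
    dsimp only at hp ⊢
    rw [if_neg, mul_zero]
    intro h
    exact hne (by ext <;> dsimp only <;> omega)
  · intro h
    exact (h (mem_antidiagonal.2 rfl)).elim

namespace Diagram

open Classical in
/-- The coefficient of a monic diagram in the composite of two candidate morphisms. -/
theorem Threaded.sum_forestPolynomial {s t c : ℕ} {z : Diagram (2 * s + (2 * t + c)) c}
    {dz : Fin c → Fin (2 * s + (2 * t + c))} (hz : z.Threaded dz) :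
    ∑ p : Diagram (2 * s + (2 * t + c)) (2 * t + c) × Diagram (2 * t + c) c with
        p.1.IsMonic ∧ p.2.IsMonic ∧ p.1.IsComposite p.2 z,
      forestPolynomial p.1.Edge * forestPolynomial p.2.Edge
      = gaussianBinomial (s + t) s * forestPolynomial z.Edge := by
  apply FaithfulSMul.algebraMap_injective ℤ[X] (FractionRing ℤ[X])
  have hρ := z.cupMap_isCupInvolution
  have hzc : (cups z.cupMap Finset.univ).card = s + t := by
    have := hz.card_cups
    omega
  have hg : algebraMap ℤ[X] (FractionRing ℤ[X]) (gaussianBinomial (s + t) s)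
      = qFact (s + t) / (qFact s * qFact t) := by
    have h := congrArg (algebraMap ℤ[X] (FractionRing ℤ[X]))
      (gaussianBinomial_mul (Nat.le_add_right s t))
    rw [Nat.add_sub_cancel_left, map_mul, map_mul] at h
    exact (eq_div_iff (mul_ne_zero (qFact_ne_zero s) (qFact_ne_zero t))).2 h
  rw [map_mul, hg, hz.forestPolynomial_edge, hzc, ← sum_lowerSets_card_eq hρ hzc hz.card_bars,
    map_sum]
  have hcup : ∀ {x : Diagram (2 * s + (2 * t + c)) (2 * t + c)} {y : Diagram (2 * t + c) c}
      {d : Fin (2 * t + c) → Fin (2 * s + (2 * t + c))}, x.Threaded d → x.IsComposite y z →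
      ∀ i, x.cupMap i ≠ i → z.cupMap i = x.cupMap i := fun hx h i hi =>
    cupMap_of_inl ((hx.isComposite_iff.1 h).1 i hi)
  -- A factorization corresponds to the cups of its left factor. These determine `x`, and then `z`
  -- determines `y`, because `Sum.map d id` is injective.
  refine Finset.sum_bij (fun p _ => cups p.1.cupMap Finset.univ) ?_ ?_ ?_ ?_
  · rintro ⟨x, y⟩ hp
    obtain ⟨-, hx, hy, h⟩ := Finset.mem_filter.1 hp
    obtain ⟨d, hd⟩ := hx.exists_threaded
    have h1 := hd.card_cups
    exact Finset.mem_filter.2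
      ⟨cups_mem_lowerSets x.cupMap_isCupInvolution (hcup hd h), by dsimp only at h1 ⊢; omega⟩
  · rintro ⟨x, y⟩ hp ⟨x', y'⟩ hp' hS
    obtain ⟨-, hx, hy, h⟩ := Finset.mem_filter.1 hp
    obtain ⟨-, hx', hy', h'⟩ := Finset.mem_filter.1 hp'
    obtain ⟨d, hd⟩ := hx.exists_threaded
    obtain ⟨d', hd'⟩ := hx'.exists_threaded
    dsimp only at hS h h' hd hd'
    have h1 := eq_cutMap hρ x.cupMap_isCupInvolution (hcup hd h)
    have h2 := eq_cutMap hρ x'.cupMap_isCupInvolution (hcup hd' h')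
    rw [hS, ← h2] at h1
    obtain ⟨rfl, rfl⟩ := hd.ext_cupMap hd' h1
    have hinj : Function.Injective (Sum.map d id :
        Fin (2 * t + c) ⊕ Fin c → Fin (2 * s + (2 * t + c)) ⊕ Fin c) :=
      Sum.map_injective.2 ⟨hd.strictMono.injective, Function.injective_id⟩
    have hy : y = y' := Diagram.ext <| funext fun p => hinj <| by
      rw [← (hd.isComposite_iff.1 h).2, ← (hd.isComposite_iff.1 h').2]
    rw [hy]
  · intro S hS
    obtain ⟨hS, hc⟩ := Finset.mem_filter.1 hS
    obtain ⟨x, y, d, d', hx, hy, h, h'⟩ := hz.exists_factorization (m := 2 * t + c) hS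
      (by rw [hc])
    exact ⟨(x, y), Finset.mem_filter.2 ⟨Finset.mem_univ _, hx.isMonic, hy.isMonic, h⟩, h'⟩
  · rintro ⟨x, y⟩ hp
    obtain ⟨-, hx, hy, h⟩ := Finset.mem_filter.1 hp
    obtain ⟨d, hd⟩ := hx.exists_threaded
    obtain ⟨d', hd'⟩ := hy.exists_threaded
    dsimp only at h hd hd' ⊢
    have hxc : (cups x.cupMap Finset.univ).card = s := by
      have := hd.card_cups
      omega
    have hyc : (cups y.cupMap Finset.univ).card = t := by
      have := hd'.card_cups
      omega
    have hτ : ∀ j, z.cupMap (d j) = d (y.cupMap j) := by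
      intro j
      have h1 := (hd.isComposite_iff.1 h).2 (Sum.inl j)
      by_cases hj : y.cupMap j = j
      · obtain ⟨l, hl⟩ := partner_inl_of_eq hj
        rw [hl] at h1
        rw [hj]
        exact cupMap_of_inr h1
      · rw [partner_inl_of_ne hj] at h1
        exact cupMap_of_inl h1
    rw [map_mul, hd.forestPolynomial_edge, hd'.forestPolynomial_edge, hxc, hyc,
      hookProd_eq_cutProd hρ x.cupMap_isCupInvolution (hcup hd h),
      hookProd_eq_hookProd_sdiff (hcup hd h) hd.strictMono hτ hd.cupMap_eq_iff]

end Diagram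

end TemperleyLieb

/-! ### The composition formula -/

theorem mainTheorem11 {R : Type*} [CommRing R] (δ : R) (a b c : ℕ) (hab : b ≤ a) (hbc : c ≤ b)
    (hab2 : a ≡ b [MOD 2]) (hbc2 : b ≡ c [MOD 2]) :
    TemperleyLieb.comp δ (TemperleyLieb.candidate δ a b) (TemperleyLieb.candidate δ b c) =
      Polynomial.aeval δ (TemperleyLieb.gaussianBinomial ((a - c) / 2) ((a - b) / 2)) •
        TemperleyLieb.candidate δ a c := by
  classical
  -- The numbers `t` and `s` count the cups of monic diagrams `y` and `x`.
  obtain ⟨t, rfl⟩ : ∃ t, b = 2 * t + c := ⟨(b - c) / 2, by unfold Nat.ModEq at hbc2; omega⟩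
  obtain ⟨s, rfl⟩ : ∃ s, a = 2 * s + (2 * t + c) :=
    ⟨(a - (2 * t + c)) / 2, by unfold Nat.ModEq at hab2; omega⟩
  rw [show (2 * s + (2 * t + c) - c) / 2 = s + t by omega,
    show (2 * s + (2 * t + c) - (2 * t + c)) / 2 = s by omega]
  funext z
  rw [Pi.smul_apply, smul_eq_mul]
  unfold TemperleyLieb.comp
  have hterm : ∀ (x : TemperleyLieb.Diagram (2 * s + (2 * t + c)) (2 * t + c))
      (y : TemperleyLieb.Diagram (2 * t + c) c),
      (if x.IsComposite y z then TemperleyLieb.candidate δ _ _ x * TemperleyLieb.candidate δ _ _ y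
        * δ ^ x.loops y else 0)
      = if x.IsMonic ∧ y.IsMonic ∧ x.IsComposite y z then
        Polynomial.aeval δ (TemperleyLieb.forestPolynomial x.Edge
          * TemperleyLieb.forestPolynomial y.Edge) else 0 := by
    intro x y
    unfold TemperleyLieb.candidate
    by_cases hx : x.IsMonic
    · obtain ⟨d, hd⟩ := hx.exists_threaded
      by_cases hy : y.IsMonic <;> simp [hx, hy, hd.loops_eq_zero]
    · simp [hx]
  simp only [hterm]
  rw [← Fintype.sum_prod_type', ← Finset.sum_filter]
  by_cases hz : z.IsMonic
  · obtain ⟨dz, hdz⟩ := hz.exists_threaded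
    rw [← map_sum, hdz.sum_forestPolynomial, map_mul, TemperleyLieb.candidate, if_pos hz]
  -- A diagram that is not monic has no factorization into monic ones, so the sum is empty.
  · rw [TemperleyLieb.candidate, if_neg hz, mul_zero]
    refine Finset.sum_eq_zero fun p hp => absurd ?_ hz
    obtain ⟨-, hx, hy, h⟩ := Finset.mem_filter.1 hp
    obtain ⟨d, hd⟩ := hx.exists_threaded
    obtain ⟨d', hd'⟩ := hy.exists_threaded
    exact (hd.of_isComposite hd' h).isMonic
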